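/- Let $\mathcal H$ be a finite-dimensional Hilbert space, let $\mathcal A\subset\mathcal B(\mathcal H)$ be a $C^*$-subalgebra containing the identity, and let $\mathcal C=\bigotimes_{k\in\mathbb Z}\mathcal A$ be the infinite spin chain, i.e. the $C^*$-inductive limit of the finite tensor products $\bigotimes_{k\in\Lambda}\mathcal A$, $\Lambda\subset\mathbb Z$ finite, with shift automorphism $\gamma$. For a state $\omega$ of $\mathcal C$ with $\omega\circ\gamma=\omega$ (a translation-invariant state) let $\omega_n=\omega_{[1,n]}$ be its restriction to $\mathcal A^{\otimes n}$ (the sites $1,\dots,n$), and let $\hat\omega_n\in\mathcal A^{\otimes n}$ be its density operator, $\omega_n(a)=\operatorname{Tr}\hat\omega_n a$ for $a\in\mathcal A^{\otimes n}$. The state $\omega$ has the upper (lower) factorization property if there are $\beta\in\mathbb R$ ($\alpha>0$) and $m_0\in\mathbb N$ such that, as functionals on $\mathcal A^{\otimes km}$, $\omega_{km}\le\beta^{k-1}\omega_m^{\otimes k}$ (respectively $\omega_{km}\ge\alpha^{k-1}\omega_m^{\otimes k}$) for all $m\ge m_0$ and $k\ge1$. For a positive semidefinite $A$, the power $A^t$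 is taken on the support of $A$, so that $A^0$ is the support projection of $A$. For $0<\kappa<1$ let $$P_{\min,\kappa}(\omega_n,\sigma_n)=\min\{\kappa\,\omega_n(1-a)+(1-\kappa)\,\sigma_n(a)\;:\;a\in\mathcal A^{\otimes n},\ 0\le a\le 1\}$$ be the minimal Bayesian error probability. Logarithms and limits are taken in $[-\infty,\infty]$, with $\log 0=-\infty$. Let $\omega$ and $\sigma$ be translation-invariant states of $\mathcal C$. (i) If $\omega$ and $\sigma$ have the upper factorization property, then for every $t\in[0,1]$ the limit $$\psi(t)=\lim_{n\to\infty}\frac1n\log\operatorname{Tr}\hat\omega_n^{1-t}\hat\sigma_n^{t}$$ exists in $[-\infty,\infty]$, and for every $0<\kappa<1$ $$\limsup_{n\to\infty}\frac1n\log P_{\min,\kappa}(\omega_n,\sigma_n)\le\inf_{0\le t\le1}\psi(t).$$ (ii) If $\omega$ and $\sigma$ have both the upper and the lower factorization property, then $\psi$ is continuous on $[0,1]$ (as a map into $[-\infty,\infty]$), it attains its minimum there, and for every $0<\kappa<1$ $$\lim_{n\to\infty}\frac1n\log P_{\min,\kappa}(\omega_n,\sigma_n)=\min_{0\le t\le1}\psi(t).$$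 -/

import Mathlib

open Filter Topology Set
open scoped ComplexOrder ENNReal

noncomputable section

namespace SpinChain

set_option linter.unusedSectionVars false

/-! ### Bounded operators on `ℓ²` given by partial injections -/

/-- The operator `(T ψ)(s) = ψ (f s)` for `s ∈ D` and `(T ψ)(s) = 0` for `s ∉ D`, on `ℓ²(S)`,
where `f` is injective on `D`. -/
def pullFun {S : Type*} (D : Set S) (f : S → S) (ψ : S → ℂ) : S → ℂ :=
  D.indicator fun s => ψ (f s)

theorem pullFun_summable {S : Type*} {D : Set S} {f : S → S} (hf : InjOn f D)
    (ψ : lp (fun _ : S => ℂ) 2) :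
    Summable (fun s => ‖pullFun D f ψ s‖ ^ (2 : ℝ≥0∞).toReal) ∧
      ∑' s, ‖pullFun D f ψ s‖ ^ (2 : ℝ≥0∞).toReal ≤ ‖ψ‖ ^ (2 : ℝ≥0∞).toReal := by
  have h2 : 0 < (2 : ℝ≥0∞).toReal := by norm_num
  have hψ := lp.hasSum_norm h2 ψ
  have key : (fun s => ‖pullFun D f ψ s‖ ^ (2 : ℝ≥0∞).toReal) =
      D.indicator fun s => ‖ψ (f s)‖ ^ (2 : ℝ≥0∞).toReal := by
    funext s
    by_cases hs : s ∈ D <;> simp [pullFun, hs]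
  have hinj : Function.Injective (fun s : D => f s) := fun a b h => Subtype.ext (hf a.2 b.2 h)
  have hsum : Summable (fun s : D => ‖ψ (f s)‖ ^ (2 : ℝ≥0∞).toReal) :=
    hψ.summable.comp_injective hinj
  rw [key]
  refine ⟨summable_subtype_iff_indicator.1 hsum, ?_⟩
  rw [← tsum_subtype D, ← hψ.tsum_eq]
  exact hsum.tsum_le_tsum_of_inj (fun s : D => f s) hinj (fun _ _ => by positivity)
    (fun _ => le_rfl) hψ.summable

def pullCLM {S : Type*} (D : Set S) (f : S → S) (hf : InjOn f D) :
    lp (fun _ : S => ℂ) 2 →L[ℂ] lp (fun _ : S => ℂ) 2 :=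
  LinearMap.mkContinuous
    { toFun := fun ψ => ⟨pullFun D f ψ, memℓp_gen (pullFun_summable hf ψ).1⟩
      map_add' := fun ψ φ => by
        ext s
        change pullFun D f (ψ + φ) s = pullFun D f ψ s + pullFun D f φ s
        by_cases hs : s ∈ D <;> simp [pullFun, hs]
      map_smul' := fun c ψ => by
        ext s
        change pullFun D f (c • ψ) s = c * pullFun D f ψ s
        by_cases hs : s ∈ D <;> simp [pullFun, hs] }
    1 (fun ψ => by
      rw [one_mul]
      exact lp.norm_le_of_tsum_le (by norm_num) (norm_nonneg _) (pullFun_summable hf ψ).2)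

theorem pullCLM_apply {S : Type*} {D : Set S} {f : S → S} (hf : InjOn f D)
    (ψ : lp (fun _ : S => ℂ) 2) (s : S) :
    pullCLM D f hf ψ s = D.indicator (fun s => ψ (f s)) s := rfl

theorem star_pullCLM {S : Type*} {D D' : Set S} {f g : S → S} (hf : InjOn f D)
    (hg : InjOn g D') (hfD : ∀ s ∈ D, f s ∈ D' ∧ g (f s) = s)
    (hgD : ∀ s ∈ D', g s ∈ D ∧ f (g s) = s) :
    star (pullCLM D f hf) = pullCLM D' g hg := by
  rw [ContinuousLinearMap.star_eq_adjoint, eq_comm, ContinuousLinearMap.eq_adjoint_iff]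
  intro φ ψ
  rw [lp.inner_eq_tsum, lp.inner_eq_tsum]
  have h1 : (fun s => inner ℂ (pullCLM D' g hg φ s) (ψ s)) =
      D'.indicator fun s => inner ℂ (φ (g s)) (ψ s) := by
    funext s
    by_cases hs : s ∈ D' <;> simp [pullCLM_apply, hs]
  have h2 : (fun s => inner ℂ (φ s) (pullCLM D f hf ψ s)) =
      D.indicator fun s => inner ℂ (φ s) (ψ (f s)) := by
    funext s
    by_cases hs : s ∈ D <;> simp [pullCLM_apply, hs]
  rw [h1, h2, ← tsum_subtype D, ← tsum_subtype D']
  let E : D ≃ D' :=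
    { toFun := fun s => ⟨f s, (hfD s s.2).1⟩
      invFun := fun s => ⟨g s, (hgD s s.2).1⟩
      left_inv := fun s => Subtype.ext (hfD s s.2).2
      right_inv := fun s => Subtype.ext (hgD s s.2).2 }
  rw [← E.tsum_eq]
  refine tsum_congr fun s => ?_
  simp only [E, Equiv.coe_fn_mk]
  rw [(hfD s s.2).2]

variable {d : Type*} [Fintype d] [DecidableEq d]

/-! ### The finite tensor powers of the one-site algebra -/

/-- The elementary tensor `⊗ᵢ aᵢ`, a matrix acting on `⊗_{i ∈ Fin n} ℂ^d`. -/
def elemTensor {n : ℕ} (a : Fin n → Matrix d d ℂ) :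
    Matrix (Fin n → d) (Fin n → d) ℂ :=
  Matrix.of fun x y => ∏ i, a i (x i) (y i)

/-- `𝒜^{⊗ n}` inside `B(ℋ^{⊗ n})`, with `ℋ = ℂ^d` and `𝒜 ⊆ B(ℋ)`. -/
def tensorAlg (𝒜 : StarSubalgebra ℂ (Matrix d d ℂ)) (n : ℕ) :
    StarSubalgebra ℂ (Matrix (Fin n → d) (Fin n → d) ℂ) :=
  StarAlgebra.adjoin ℂ {M | ∃ a : Fin n → Matrix d d ℂ, (∀ i, a i ∈ 𝒜) ∧ M = elemTensor a}

/-! ### The infinite chain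

The local algebras are realized faithfully as operators on `ℓ²` of all configurations `ℤ → d`,
an operator of `⊗_{i ∈ Fin n} ℂ^d` acting on the sites `e 0, …, e (n - 1)` and as the identity on
the other sites. The norm closure of their union is the `C*`-inductive limit. -/

/-- The Hilbert space `ℓ²(ℤ → d)`. -/
abbrev ConfSpace (d : Type*) : Type _ := lp (fun _ : ℤ → d => ℂ) 2

/-- The matrix unit `|x⟩⟨y|` placed at the sites `e 0, …, e (n - 1)`. -/
def unitAt {n : ℕ} (e : Fin n ↪ ℤ) (x y : Fin n → d) : ConfSpace d →L[ℂ] ConfSpace d :=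
  pullCLM {s : ℤ → d | s ∘ e = x} (fun s => Function.extend e y s) (by
    intro s hs s' hs' h
    funext k
    by_cases hk : ∃ i, e i = k
    · obtain ⟨i, rfl⟩ := hk
      have h1 : (s ∘ e) i = (s' ∘ e) i := by rw [hs, hs']
      exact h1
    · have := congrFun h k
      simpa [Function.extend_apply' _ _ _ hk] using this)

theorem unitAt_apply {n : ℕ} (e : Fin n ↪ ℤ) (x y : Fin n → d) (ψ : ConfSpace d) (s : ℤ → d) :
    unitAt e x y ψ s =
      {s : ℤ → d | s ∘ e = x}.indicator (fun s => ψ (Function.extend e y s)) s := rfl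

theorem extend_comp {n : ℕ} (e : Fin n ↪ ℤ) (y : Fin n → d) (s : ℤ → d) :
    Function.extend e y s ∘ e = y := by
  funext i
  exact e.injective.extend_apply _ _ _

theorem extend_extend {n : ℕ} (e : Fin n ↪ ℤ) (y z : Fin n → d) (s : ℤ → d) :
    Function.extend e z (Function.extend e y s) = Function.extend e z s := by
  funext k
  by_cases hk : ∃ i, e i = k
  · obtain ⟨i, rfl⟩ := hk
    simp [e.injective.extend_apply]
  · simp [Function.extend_apply' _ _ _ hk]

theorem extend_self {n : ℕ} (e : Fin n ↪ ℤ) (s : ℤ → d) :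
    Function.extend e (s ∘ e) s = s := by
  funext k
  by_cases hk : ∃ i, e i = k
  · obtain ⟨i, rfl⟩ := hk
    simp [e.injective.extend_apply]
  · simp [Function.extend_apply' _ _ _ hk]

theorem star_unitAt {n : ℕ} (e : Fin n ↪ ℤ) (x y : Fin n → d) :
    star (unitAt e x y) = unitAt e y x := by
  refine star_pullCLM _ _ (fun s hs => ⟨extend_comp e y s, ?_⟩) (fun s hs => ⟨extend_comp e x s, ?_⟩)
  · rw [extend_extend, ← (hs : s ∘ e = x), extend_self]
  · rw [extend_extend, ← (hs : s ∘ e = y), extend_self]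

/-- The matrix `a` placed at the sites `e 0, …, e (n - 1)`. -/
def placeFun {n : ℕ} (e : Fin n ↪ ℤ) (a : Matrix (Fin n → d) (Fin n → d) ℂ) :
    ConfSpace d →L[ℂ] ConfSpace d :=
  ∑ x, ∑ y, a x y • unitAt e x y

theorem placeFun_apply {n : ℕ} (e : Fin n ↪ ℤ) (a : Matrix (Fin n → d) (Fin n → d) ℂ)
    (ψ : ConfSpace d) (s : ℤ → d) :
    placeFun e a ψ s = ∑ y, a (s ∘ e) y * ψ (Function.extend e y s) := by
  have h : placeFun e a ψ s = ∑ x, ∑ y, a x y * (unitAt e x y ψ) s := by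
    let ev : ConfSpace d →ₗ[ℂ] ℂ :=
      { toFun := fun φ => φ s, map_add' := fun _ _ => rfl, map_smul' := fun _ _ => rfl }
    change ev (placeFun e a ψ) = ∑ x, ∑ y, a x y * ev (unitAt e x y ψ)
    simp [placeFun]
  rw [h, Finset.sum_eq_single (s ∘ e)]
  · refine Finset.sum_congr rfl fun y _ => ?_
    have : s ∈ {s' : ℤ → d | s' ∘ e = s ∘ e} := rfl
    rw [unitAt_apply, Set.indicator_of_mem this]
  · intro x _ hx
    refine Finset.sum_eq_zero fun y _ => ?_
    have : s ∉ {s : ℤ → d | s ∘ e = x} := fun h => hx h.symm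
    rw [unitAt_apply, Set.indicator_of_notMem this, mul_zero]
  · simp

/-- The embedding of `B(ℋ^{⊗ n})` onto the operators at the sites `e 0, …, e (n - 1)`. -/
def place {n : ℕ} (e : Fin n ↪ ℤ) :
    Matrix (Fin n → d) (Fin n → d) ℂ →⋆ₐ[ℂ] (ConfSpace d →L[ℂ] ConfSpace d) where
  toFun := placeFun e
  map_one' := by
    ext ψ s
    simp [placeFun_apply, Matrix.one_apply, extend_self]
  map_mul' a b := by
    ext ψ s
    simp only [placeFun_apply, Matrix.mul_apply, mul_apply_eq_comp, extend_comp,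
      extend_extend, Finset.sum_mul, Finset.mul_sum]
    rw [Finset.sum_comm]
    simp [mul_assoc]
  map_zero' := by simp [placeFun]
  map_add' a b := by simp [placeFun, add_smul, Finset.sum_add_distrib]
  commutes' c := by
    ext ψ s
    simp [placeFun_apply, Matrix.one_apply, extend_self, Algebra.algebraMap_eq_smul_one]
  map_star' a := by
    simp only [placeFun, star_sum, star_smul, star_unitAt, Matrix.star_apply]
    rw [Finset.sum_comm]

/-- The spin chain `⊗_{k ∈ ℤ} 𝒜`. -/
def chain (𝒜 : StarSubalgebra ℂ (Matrix d d ℂ)) :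
    StarSubalgebra ℂ (ConfSpace d →L[ℂ] ConfSpace d) :=
  (StarAlgebra.adjoin ℂ
    {T | ∃ (n : ℕ) (e : Fin n ↪ ℤ), ∃ a ∈ tensorAlg 𝒜 n, T = place e a}).topologicalClosure

theorem place_mem (𝒜 : StarSubalgebra ℂ (Matrix d d ℂ)) {n : ℕ} (e : Fin n ↪ ℤ)
    (a : tensorAlg 𝒜 n) : place e (a : Matrix (Fin n → d) (Fin n → d) ℂ) ∈ chain 𝒜 :=
  StarSubalgebra.le_topologicalClosure _
    (StarAlgebra.subset_adjoin ℂ _ ⟨n, e, a, a.2, rfl⟩)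

/-! ### The shift -/

/-- The unitary `(U ψ)(s) = ψ (k ↦ s (k + 1))` that moves every site one step to the right. -/
def shiftU : unitary (ConfSpace d →L[ℂ] ConfSpace d) :=
  have hf : ∀ c : ℤ, InjOn (fun (s : ℤ → d) (k : ℤ) => s (k + c)) univ := by
    intro c s _ s' _ h
    funext k
    simpa using congrFun h (k - c)
  have hs : star (pullCLM univ _ (hf 1)) = pullCLM univ _ (hf (-1)) :=
    star_pullCLM _ _ (fun s _ => ⟨mem_univ _, by funext k; simp⟩)
      (fun s _ => ⟨mem_univ _, by funext k; simp⟩)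
  ⟨pullCLM univ _ (hf 1), Unitary.mem_iff.2 ⟨by
    rw [hs]
    ext ψ s
    simp [pullCLM_apply], by
    rw [hs]
    ext ψ s
    simp [pullCLM_apply]⟩⟩

theorem shiftU_apply (ψ : ConfSpace d) (s : ℤ → d) :
    (shiftU : unitary (ConfSpace d →L[ℂ] ConfSpace d)).1 ψ s = ψ (fun k => s (k + 1)) := by
  simp [shiftU, pullCLM_apply]

theorem shiftU_place {n : ℕ} (e : Fin n ↪ ℤ) (a : Matrix (Fin n → d) (Fin n → d) ℂ) :
    Unitary.conjStarAlgAut ℂ _ shiftU (place e a) =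
      place (e.trans (addRightEmbedding 1)) a := by
  have h : shiftU.1 * place e a =
      place (e.trans (addRightEmbedding 1)) a * (shiftU : unitary (ConfSpace d →L[ℂ] _)).1 := by
    ext ψ s
    change shiftU.1 (placeFun e a ψ) s = placeFun (e.trans (addRightEmbedding 1)) a (shiftU.1 ψ) s
    rw [shiftU_apply, placeFun_apply, placeFun_apply]
    refine Finset.sum_congr rfl fun y _ => ?_
    rw [shiftU_apply]
    refine congrArg (fun s' => a ((s ∘ fun k => k + 1) ∘ e) y * ψ s') ?_
    funext k
    by_cases hk : ∃ i, e i = k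
    · obtain ⟨i, rfl⟩ := hk
      have := (e.trans (addRightEmbedding (1 : ℤ))).injective.extend_apply y s i
      rw [e.injective.extend_apply]
      exact this.symm
    · rw [Function.extend_apply' _ _ _ hk, Function.extend_apply']
      rintro ⟨i, hi⟩
      exact hk ⟨i, by simpa using hi⟩
  rw [Unitary.conjStarAlgAut_apply, h, mul_assoc, Unitary.mul_star_self_of_mem shiftU.2, mul_one]

theorem shift_mem (𝒜 : StarSubalgebra ℂ (Matrix d d ℂ)) (T : chain 𝒜) :
    Unitary.conjStarAlgAut ℂ _ shiftU (T : ConfSpace d →L[ℂ] ConfSpace d) ∈ chain 𝒜 := by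
  have hcont : Continuous (fun T : ConfSpace d →L[ℂ] ConfSpace d =>
      Unitary.conjStarAlgAut ℂ _ shiftU T) := by
    simp only [Unitary.conjStarAlgAut_apply]
    fun_prop
  refine map_mem_closure hcont T.2 fun S hS => ?_
  have hle : StarAlgebra.adjoin ℂ
      {T | ∃ (n : ℕ) (e : Fin n ↪ ℤ), ∃ a ∈ tensorAlg 𝒜 n, T = place e a} ≤
      (StarAlgebra.adjoin ℂ
        {T | ∃ (n : ℕ) (e : Fin n ↪ ℤ), ∃ a ∈ tensorAlg 𝒜 n, T = place e a}).comap
        (Unitary.conjStarAlgAut ℂ _ shiftU : _ ≃⋆ₐ[ℂ] _).toStarAlgHom := by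
    refine StarAlgebra.adjoin_le ?_
    rintro _ ⟨n, e, a, ha, rfl⟩
    exact StarAlgebra.subset_adjoin ℂ _ ⟨n, _, a, ha, shiftU_place e a⟩
  exact hle hS

/-- The shift `γ` of the chain; it maps `a` at the sites `e i` to `a` at the sites `e i + 1`. -/
def shift (𝒜 : StarSubalgebra ℂ (Matrix d d ℂ)) (T : chain 𝒜) : chain 𝒜 :=
  ⟨Unitary.conjStarAlgAut ℂ _ shiftU (T : ConfSpace d →L[ℂ] ConfSpace d), shift_mem 𝒜 T⟩

/-! ### States and their local restrictions -/

/-- A state of the chain. -/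
structure State (𝒜 : StarSubalgebra ℂ (Matrix d d ℂ)) where
  toLin : chain 𝒜 →ₗ[ℂ] ℂ
  nonneg : ∀ T, 0 ≤ toLin (star T * T)
  map_one : toLin 1 = 1

variable {𝒜 : StarSubalgebra ℂ (Matrix d d ℂ)}

def State.TranslationInvariant (ω : State 𝒜) : Prop :=
  ∀ T, ω.toLin (shift 𝒜 T) = ω.toLin T

/-- The sites `1, …, n`. -/
def sites (n : ℕ) : Fin n ↪ ℤ :=
  ⟨fun i => (i : ℤ) + 1, fun i j h => by
    have h' : ((i : ℕ) : ℤ) + 1 = ((j : ℕ) : ℤ) + 1 := h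
    exact Fin.ext (by omega)⟩

/-- The restriction `ω_n = ω_{[1,n]}`, a functional on `𝒜^{⊗ n}`. -/
def State.loc (ω : State 𝒜) (n : ℕ) : tensorAlg 𝒜 n →ₗ[ℂ] ℂ where
  toFun a := ω.toLin ⟨place (sites n) (a : Matrix (Fin n → d) (Fin n → d) ℂ),
    place_mem 𝒜 (sites n) a⟩
  map_add' a b := by
    rw [← map_add]
    congr 1
    ext1
    simp
  map_smul' c a := by
    rw [← map_smul]
    congr 1
    ext1
    simp

/-- Every functional on a `*`-algebra of matrices has a unique density in that algebra. -/
theorem existsUnique_density {N : Type*} [Fintype N] [DecidableEq N]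
    (B : StarSubalgebra ℂ (Matrix N N ℂ)) (f : B →ₗ[ℂ] ℂ) :
    ∃! ρ : B, ∀ a : B, f a = (((ρ : Matrix N N ℂ)) * (a : Matrix N N ℂ)).trace := by
  let L : B →ₗ[ℂ] (B →ₗ[ℂ] ℂ) := LinearMap.mk₂ ℂ
    (fun r a => ((r : Matrix N N ℂ) * (a : Matrix N N ℂ)).trace)
    (by intros; simp [add_mul]) (by intros; simp) (by intros; simp [mul_add]) (by intros; simp)
  have hinj : Function.Injective L := by
    rw [← LinearMap.ker_eq_bot, LinearMap.ker_eq_bot']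
    intro r hr
    have h : ((r : Matrix N N ℂ) * (star r : B).1).trace = 0 := LinearMap.congr_fun hr (star r)
    have h' : (r : Matrix N N ℂ) = 0 := by
      have h2 : ((r : Matrix N N ℂ) * (r : Matrix N N ℂ).conjTranspose).trace = 0 := h
      rwa [Matrix.trace_mul_conjTranspose_self_eq_zero_iff] at h2
    exact Subtype.ext h'
  have hfd : FiniteDimensional ℂ B :=
    inferInstanceAs (FiniteDimensional ℂ (Subalgebra.toSubmodule B.toSubalgebra))
  have hsurj : Function.Surjective L :=
    (LinearMap.injective_iff_surjective_of_finrank_eq_finrank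
      (Subspace.dual_finrank_eq (K := ℂ) (V := B)).symm).1 hinj
  obtain ⟨r, hr⟩ := hsurj f
  refine ⟨r, fun a => by rw [← hr]; rfl, fun r' hr' => hinj ?_⟩
  rw [hr]
  ext a
  exact (hr' a).symm

/-- The density operator `ω̂_n ∈ 𝒜^{⊗ n}` : `ω_n(a) = Tr ω̂_n a` for all `a ∈ 𝒜^{⊗ n}`. -/
def State.density (ω : State 𝒜) (n : ℕ) : Matrix (Fin n → d) (Fin n → d) ℂ :=
  ((existsUnique_density (tensorAlg 𝒜 n) (ω.loc n)).choose : tensorAlg 𝒜 n)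

theorem State.loc_eq_trace (ω : State 𝒜) (n : ℕ) (a : tensorAlg 𝒜 n) :
    ω.loc n a = (ω.density n * (a : Matrix (Fin n → d) (Fin n → d) ℂ)).trace :=
  (existsUnique_density (tensorAlg 𝒜 n) (ω.loc n)).choose_spec.1 a

/-- `ρ^{⊗ k}` for a matrix `ρ` on `m` sites; the `i`-th factor acts on the sites
`i m, …, i m + m - 1` of `Fin (k * m)`. -/
def tensorPow (k : ℕ) {m : ℕ} (ρ : Matrix (Fin m → d) (Fin m → d) ℂ) :
    Matrix (Fin (k * m) → d) (Fin (k * m) → d) ℂ :=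
  Matrix.of fun x y => ∏ i : Fin k,
    ρ (fun j => x (finProdFinEquiv (i, j))) (fun j => y (finProdFinEquiv (i, j)))

/-- `ω_{[1,km]} ≤ β^{k-1} ω_{[1,m]}^{⊗ k}` as functionals on `𝒜^{⊗ km}`, for all `m ≥ m₀`,
`k ≥ 1`. -/
def State.UpperFactorization (ω : State 𝒜) : Prop :=
  ∃ (β : ℝ) (m₀ : ℕ), ∀ m ≥ m₀, ∀ k ≥ 1, ∀ a : tensorAlg 𝒜 (k * m), a.1.PosSemidef →
    (ω.loc (k * m) a).re ≤ β ^ (k - 1) * ((tensorPow k (ω.density m) * a.1).trace).re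

/-- `ω_{[1,km]} ≥ α^{k-1} ω_{[1,m]}^{⊗ k}` as functionals on `𝒜^{⊗ km}`, for all `m ≥ m₀`,
`k ≥ 1`, with a constant `α > 0` (for `α = 0` the inequality is void). -/
def State.LowerFactorization (ω : State 𝒜) : Prop :=
  ∃ (α : ℝ) (m₀ : ℕ), 0 < α ∧ ∀ m ≥ m₀, ∀ k ≥ 1, ∀ a : tensorAlg 𝒜 (k * m), a.1.PosSemidef →
    α ^ (k - 1) * ((tensorPow k (ω.density m) * a.1).trace).re ≤ (ω.loc (k * m) a).re

/-! ### Chernoff quantities -/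

/-- The power `A ^ t` of a positive semidefinite matrix, taken on the support of `A`;
in particular `A ^ 0` is the support projection. -/
def suppPow {N : Type*} [Fintype N] [DecidableEq N] (A : Matrix N N ℂ) (t : ℝ) : Matrix N N ℂ :=
  cfc (fun x : ℝ => if x = 0 then 0 else x ^ t) A

/-- `Tr ω̂_n^{1-t} σ̂_n^t`. -/
def chernoffTrace (ω σ : State 𝒜) (n : ℕ) (t : ℝ) : ℝ :=
  ((suppPow (ω.density n) (1 - t) * suppPow (σ.density n) t).trace).re

/-- The Bayesian error probability `κ ω_n(1 - a) + (1 - κ) σ_n(a)` of the test `a`. -/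
def errorProb (κ : ℝ) (ω σ : State 𝒜) (n : ℕ) (a : tensorAlg 𝒜 n) : ℝ :=
  κ * (ω.loc n (1 - a)).re + (1 - κ) * (σ.loc n a).re

/-- The minimal error probability over the tests `0 ≤ a ≤ 1` in `𝒜^{⊗ n}`. -/
def minError (κ : ℝ) (ω σ : State 𝒜) (n : ℕ) : ℝ :=
  sInf {p | ∃ a : tensorAlg 𝒜 n, a.1.PosSemidef ∧ (1 - a.1).PosSemidef ∧
    p = errorProb κ ω σ n a}

/-- `(1/n) log x` in `[-∞, ∞]`, for `x ≥ 0`, with `log 0 = -∞`. -/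
def rate (n : ℕ) (x : ℝ) : EReal :=
  ((1 / n : ℝ) : EReal) * ENNReal.log (ENNReal.ofReal x)

end SpinChain

end

noncomputable section

namespace SpinChain

set_option linter.unusedSectionVars false

/-! ### Functional calculus of Hermitian matrices and operator monotone powers -/

section MatrixCalculus

open Matrix
open scoped MatrixOrder

variable {N M : Type*} [Fintype N] [DecidableEq N] [Fintype M] [DecidableEq M]

/-! Upper bound on the error. For positive matrices R, S, the projection onto the positive part of R
- S has total error at most Tr R^(1-t) S^t for every t in [0,1] (Audenaert et al.,
`exists_test_le_trace_suppPow`). With R = κ ω̂_n and S = (1-κ) σ̂_n the priors only contribute a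
factor at most 1, so the limsup bound already holds at each n and t.

Existence of ψ is a Fekete argument for c_n = Tr ω̂_n^(1-t) σ̂_n^t. Since x^t is operator monotone,
ω̂_{km} ≤ b^(k-1) ω̂_m^{⊗k} and its analogue for σ give c_{km} ≤ b^(k-1) c_m^k. Lengths that are not
multiples of m are reached through ω̂_{n+1} ≤ (dim + 1) ω̂_n ⊗ 1, valid for every state
(`State.density_succ_le`).

Under lower factorization also c_m^k ≤ b^(k-1) c_{km}. Either some c_m with m large vanishes, and
then it vanishes for all t and ψ is constantly -∞, or (1/m) log c_m lies within (log b)/m of ψ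
uniformly in t, and ψ is continuous as a uniform limit.

Lower bound on the error. Lower factorization replaces both states on km sites by product states at
the cost b^(k-1). The bound of Nussbaum and Szkoła (`half_sum_min_le_error`) reduces the product
states to k independent samples of a classical pair (p, q) with ∑ p^(1-t) q^t = c_m. For the
classical pair, tilting at the minimizing t, a second moment and Jensen's inequality give a bound
with loss exp(-C√k) only (`exists_exponent`). Letting k and then m tend to infinity finishes the
proof. -/

theorem exists_polynomial_cfc (f : ℝ → ℝ) {A : Matrix N N ℂ} (hA : A.IsHermitian)
    (s : Set ℝ) (hs : s.Finite) :
    ∃ p : Polynomial ℝ, cfc f A = Polynomial.aeval A p ∧ ∀ x ∈ s, p.eval x = f x := by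
  classical
  -- Lagrange interpolation on the finite spectrum; the extra nodes `s` let one polynomial serve a
  -- second matrix too.
  let F : Finset ℝ := (hs.union A.finite_real_spectrum).toFinset
  have hp : ∀ x ∈ F, (Lagrange.interpolate F id f).eval x = f x := fun x hx =>
    Lagrange.eval_interpolate_at_node f (Function.injective_id.injOn) hx
  refine ⟨Lagrange.interpolate F id f, ?_, fun x hx => hp x (by simp [F, hx])⟩
  rw [← cfc_polynomial (Lagrange.interpolate F id f) A hA.isSelfAdjoint]
  exact cfc_congr fun x hx => (hp x (by simp [F, hx])).symm

/-- A polynomial that interpolates `f` on both spectra computes both sides, and polynomials commute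
with homomorphisms. -/
theorem map_cfc_of_isHermitian (φ : Matrix N N ℂ →⋆ₐ[ℂ] Matrix M M ℂ) (f : ℝ → ℝ)
    {A : Matrix N N ℂ} (hA : A.IsHermitian) : φ (cfc f A) = cfc f (φ A) := by
  have hφ : (φ A).IsHermitian := by
    have : star A = A := hA
    change star (φ A) = φ A
    rw [← map_star, this]
  obtain ⟨p, hp, hps⟩ := exists_polynomial_cfc f hA _ (φ A).finite_real_spectrum
  rw [hp, ← cfc_congr (f := p.eval) hps, cfc_polynomial p _ hφ.isSelfAdjoint]
  exact (Polynomial.aeval_algHom_apply (φ.toAlgHom.restrictScalars ℝ) A p).symm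

/-- This keeps the tests inside the algebra: spectral projections, negative parts and square roots
of elements of `B` stay in `B`. -/
theorem cfc_mem_starSubalgebra (B : StarSubalgebra ℂ (Matrix N N ℂ)) (f : ℝ → ℝ)
    {A : Matrix N N ℂ} (hA : A.IsHermitian) (hAB : A ∈ B) : cfc f A ∈ B := by
  obtain ⟨p, hp, -⟩ := exists_polynomial_cfc f hA ∅ finite_empty
  rw [hp, Polynomial.aeval_eq_sum_range]
  refine sum_mem fun i _ => ?_
  rw [← algebraMap_smul ℂ]
  exact SMulMemClass.smul_mem _ (pow_mem hAB i)

/-- The matrix `U diag(a) U*`. -/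
def unitaryDiag (U : Matrix N N ℂ) (a : N → ℝ) : Matrix N N ℂ :=
  U * diagonal (fun i => (a i : ℂ)) * star U

theorem unitaryDiag_apply (U : Matrix N N ℂ) (a : N → ℝ) (x y : N) :
    unitaryDiag U a x y = ∑ i, (a i : ℂ) * (U x i * star (U y i)) := by
  rw [unitaryDiag, mul_apply]
  simp only [mul_diagonal, star_apply]
  exact Finset.sum_congr rfl fun i _ => by ring

theorem isHermitian_unitaryDiag (U : Matrix N N ℂ) (a : N → ℝ) :
    (unitaryDiag U a).IsHermitian := by
  ext x y
  simp only [conjTranspose_apply, unitaryDiag_apply, star_sum, star_mul', star_star]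
  exact Finset.sum_congr rfl fun i _ => by simp [mul_comm]

theorem unitaryDiag_mul {U : Matrix N N ℂ} (hU : U ∈ unitary (Matrix N N ℂ)) (a b : N → ℝ) :
    unitaryDiag U a * unitaryDiag U b = unitaryDiag U (fun i => a i * b i) := by
  have h : star U * U = 1 := Unitary.star_mul_self_of_mem hU
  calc unitaryDiag U a * unitaryDiag U b
      = U * diagonal (fun i => (a i : ℂ)) * (star U * U) * diagonal (fun i => (b i : ℂ)) *
          star U := by simp only [unitaryDiag, mul_assoc]
    _ = _ := by
      rw [h, mul_one, mul_assoc U, diagonal_mul_diagonal]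
      simp [unitaryDiag]

theorem cfc_unitaryDiag {U : Matrix N N ℂ} (hU : U ∈ unitary (Matrix N N ℂ)) (f : ℝ → ℝ)
    (a : N → ℝ) : cfc f (unitaryDiag U a) = unitaryDiag U (fun i => f (a i)) := by
  obtain ⟨p, hp, hps⟩ := exists_polynomial_cfc f (isHermitian_unitaryDiag U a) _
    (finite_range a)
  have key : ∀ n : ℕ, unitaryDiag U a ^ n = unitaryDiag U (fun i => a i ^ n) := by
    intro n
    induction n with
    | zero => simp [unitaryDiag, Unitary.mul_star_self_of_mem hU]
    | succ n ih => rw [pow_succ, ih, unitaryDiag_mul hU]; simp [pow_succ]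
  rw [hp, Polynomial.aeval_eq_sum_range]
  ext x y
  simp only [key, Matrix.sum_apply, Matrix.smul_apply, unitaryDiag_apply, Finset.smul_sum]
  rw [Finset.sum_comm]
  refine Finset.sum_congr rfl fun i _ => ?_
  rw [← hps _ (mem_range_self i), Polynomial.eval_eq_sum_range]
  push_cast
  rw [Finset.sum_mul]
  exact Finset.sum_congr rfl fun n _ => by
    rw [Complex.real_smul]
    ring

theorem exists_unitaryDiag {A : Matrix N N ℂ} (hA : A.PosSemidef) :
    ∃ U ∈ unitary (Matrix N N ℂ), ∃ a : N → ℝ, (∀ i, 0 ≤ a i) ∧ A = unitaryDiag U a := by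
  refine ⟨hA.1.eigenvectorUnitary, hA.1.eigenvectorUnitary.2, hA.1.eigenvalues,
    hA.eigenvalues_nonneg, ?_⟩
  conv_lhs => rw [hA.1.spectral_theorem, Unitary.conjStarAlgAut_apply]
  rfl

theorem posSemidef_unitaryDiag (U : Matrix N N ℂ) {a : N → ℝ} (ha : ∀ i, 0 ≤ a i) :
    (unitaryDiag U a).PosSemidef := by
  have : (diagonal fun i => (a i : ℂ)).PosSemidef :=
    PosSemidef.diagonal fun i => by simpa using ha i
  exact this.mul_mul_conjTranspose_same U

/-! ### Positivity of traces -/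

theorem trace_mul_re_nonneg {A B : Matrix N N ℂ} (hA : A.PosSemidef) (hB : B.PosSemidef) :
    0 ≤ ((A * B).trace).re := by
  obtain ⟨U, hU, a, ha, rfl⟩ := exists_unitaryDiag hA
  have h := (hB.conjTranspose_mul_mul_same U)
  have h2 : (unitaryDiag U a * B).trace = (diagonal (fun i => (a i : ℂ)) * (Uᴴ * B * U)).trace := by
    rw [unitaryDiag, mul_assoc, mul_assoc, trace_mul_comm]
    simp only [mul_assoc]
    rfl
  rw [h2, trace, Complex.re_sum]
  refine Finset.sum_nonneg fun i _ => ?_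
  simp only [diag_apply, diagonal_mul]
  have := (Complex.nonneg_iff.1 (h.diag_nonneg (i := i))).1
  simpa using mul_nonneg (ha i) this

theorem trace_mul_re_mono {A A' B B' : Matrix N N ℂ} (hA : A.PosSemidef) (hB' : B'.PosSemidef)
    (hAA : A ≤ A') (hBB : B ≤ B') : ((A * B).trace).re ≤ ((A' * B').trace).re := by
  have h1 := trace_mul_re_nonneg hA (Matrix.le_iff.1 hBB)
  have h2 := trace_mul_re_nonneg (Matrix.le_iff.1 hAA) hB'
  rw [mul_sub, trace_sub, Complex.sub_re] at h1
  rw [sub_mul, trace_sub, Complex.sub_re] at h2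
  linarith

/-! ### Powers on the support -/

theorem suppPow_unitaryDiag {U : Matrix N N ℂ} (hU : U ∈ unitary (Matrix N N ℂ)) (a : N → ℝ)
    (t : ℝ) : suppPow (unitaryDiag U a) t =
      unitaryDiag U (fun i => if a i = 0 then 0 else a i ^ t) :=
  cfc_unitaryDiag hU _ a

theorem suppPow_posSemidef {A : Matrix N N ℂ} (hA : A.PosSemidef) (t : ℝ) :
    (suppPow A t).PosSemidef := by
  obtain ⟨U, hU, a, ha, rfl⟩ := exists_unitaryDiag hA
  rw [suppPow_unitaryDiag hU]
  refine posSemidef_unitaryDiag U fun i => ?_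
  split_ifs
  · exact le_rfl
  · exact Real.rpow_nonneg (ha i) t

theorem suppPow_mul_suppPow {A : Matrix N N ℂ} (hA : A.PosSemidef) (t : ℝ) :
    suppPow A (1 - t) * suppPow A t = A := by
  obtain ⟨U, hU, a, ha, rfl⟩ := exists_unitaryDiag hA
  rw [suppPow_unitaryDiag hU, suppPow_unitaryDiag hU, unitaryDiag_mul hU]
  congr 1
  funext i
  by_cases h : a i = 0
  · simp [h]
  · rw [if_neg h, if_neg h, ← Real.rpow_add (lt_of_le_of_ne (ha i) (Ne.symm h))]
    simp

theorem suppPow_smul {A : Matrix N N ℂ} (hA : A.PosSemidef) {c : ℝ} (hc : 0 < c) (t : ℝ) :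
    suppPow ((c : ℂ) • A) t = ((c ^ t : ℝ) : ℂ) • suppPow A t := by
  obtain ⟨U, hU, a, ha, rfl⟩ := exists_unitaryDiag hA
  have h : ∀ (c : ℝ) (a : N → ℝ), (c : ℂ) • unitaryDiag U a = unitaryDiag U fun i => c * a i := by
    intro c a
    ext x y
    simp [unitaryDiag_apply, Finset.mul_sum, mul_assoc]
  rw [h, suppPow_unitaryDiag hU, suppPow_unitaryDiag hU, h]
  congr 1
  funext i
  by_cases hi : a i = 0
  · simp [hi]
  · rw [if_neg hi, if_neg (mul_ne_zero hc.ne' hi), Real.mul_rpow hc.le (ha i)]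

theorem suppPow_map (φ : Matrix N N ℂ →⋆ₐ[ℂ] Matrix M M ℂ) {A : Matrix N N ℂ}
    (hA : A.IsHermitian) (t : ℝ) : suppPow (φ A) t = φ (suppPow A t) :=
  (map_cfc_of_isHermitian φ _ hA).symm

theorem continuous_suppPow {A : Matrix N N ℂ} (hA : A.PosSemidef) :
    Continuous fun t : ℝ => suppPow A t := by
  obtain ⟨U, hU, a, ha, rfl⟩ := exists_unitaryDiag hA
  simp only [suppPow_unitaryDiag hU]
  refine continuous_pi fun x => continuous_pi fun y => ?_
  simp only [unitaryDiag_apply]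
  refine continuous_finsetSum _ fun i _ => Continuous.mul ?_ continuous_const
  refine Complex.continuous_ofReal.comp ?_
  by_cases h : a i = 0
  · simpa [h] using continuous_const
  · simp only [h, if_false]
    exact Real.continuous_const_rpow h

section
open scoped Matrix.Norms.L2Operator

theorem suppPow_eq_rpow {A : Matrix N N ℂ} (hA : A.PosSemidef) {t : ℝ} (ht : 0 < t) :
    suppPow A t = CFC.rpow A t := by
  have h : CFC.rpow A t = cfc (fun x : ℝ => x ^ t) A := CFC.rpow_eq_cfc_real hA.nonneg
  rw [h, suppPow]
  congr 1
  funext x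
  split_ifs with hx
  · rw [hx, Real.zero_rpow ht.ne']
  · rfl

theorem suppPow_mono_of_pos {A B : Matrix N N ℂ} (hA : A.PosSemidef) (hAB : A ≤ B) {t : ℝ}
    (ht : t ∈ Ioc (0 : ℝ) 1) : suppPow A t ≤ suppPow B t := by
  have hB : B.PosSemidef := (hA.nonneg.trans hAB).posSemidef
  rw [suppPow_eq_rpow hA ht.1, suppPow_eq_rpow hB ht.1]
  exact CFC.rpow_le_rpow (Ioc_subset_Icc_self ht) hAB

end

theorem isClosed_posSemidef : IsClosed {A : Matrix N N ℂ | A.PosSemidef} := by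
  simp only [posSemidef_iff_dotProduct_mulVec, ofPred_and, ofPred_forall]
  refine IsClosed.inter ?_ (isClosed_iInter fun x => ?_)
  · exact isClosed_eq (by fun_prop) (by fun_prop)
  · exact isClosed_le continuous_const (by fun_prop)

/-- Operator monotonicity of the powers `t ∈ [0, 1]`, the support projection included. -/
theorem suppPow_mono {A B : Matrix N N ℂ} (hA : A.PosSemidef) (hAB : A ≤ B) {t : ℝ}
    (ht : t ∈ Icc (0 : ℝ) 1) : suppPow A t ≤ suppPow B t := by
  have hB : B.PosSemidef := (hA.nonneg.trans hAB).posSemidef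
  have hcont : Continuous fun s : ℝ => suppPow B s - suppPow A s :=
    (continuous_suppPow hB).sub (continuous_suppPow hA)
  -- The Löwner–Heinz inequality covers `t > 0`. At `t = 0` the support projections are limits of
  -- the powers, because zero eigenvalues stay at 0 for every exponent, and the positive cone is
  -- closed.
  have hcl : IsClosed {s : ℝ | (suppPow B s - suppPow A s).PosSemidef} :=
    isClosed_posSemidef.preimage hcont
  have hsub : closure (Ioc (0 : ℝ) 1) ⊆ {s : ℝ | (suppPow B s - suppPow A s).PosSemidef} :=
    closure_minimal (fun s hs => suppPow_mono_of_pos hA hAB hs) hcl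
  rw [closure_Ioc zero_ne_one] at hsub
  exact hsub ht

end MatrixCalculus

/-! ### Upper and lower bounds for the error of a quantum test -/

section Tests

open Matrix
open scoped MatrixOrder

variable {N : Type*} [Fintype N] [DecidableEq N]

theorem exists_unitaryDiag_of_isHermitian {A : Matrix N N ℂ} (hA : A.IsHermitian) :
    ∃ U ∈ unitary (Matrix N N ℂ), ∃ a : N → ℝ, A = unitaryDiag U a := by
  refine ⟨hA.eigenvectorUnitary, hA.eigenvectorUnitary.2, hA.eigenvalues, ?_⟩
  conv_lhs => rw [hA.spectral_theorem, Unitary.conjStarAlgAut_apply]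
  rfl

theorem unitaryDiag_sub (U : Matrix N N ℂ) (a b : N → ℝ) :
    unitaryDiag U a - unitaryDiag U b = unitaryDiag U (fun i => a i - b i) := by
  ext x y
  simp only [Matrix.sub_apply, unitaryDiag_apply, ← Finset.sum_sub_distrib]
  exact Finset.sum_congr rfl fun i _ => by push_cast; ring

theorem unitaryDiag_one {U : Matrix N N ℂ} (hU : U ∈ unitary (Matrix N N ℂ)) :
    unitaryDiag U (fun _ => 1) = 1 := by
  simp [unitaryDiag, Unitary.mul_star_self_of_mem hU]

/-- A Hermitian element of a `*`-algebra of matrices that is positive as a functional on the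
algebra is positive semidefinite. -/
theorem posSemidef_of_trace_nonneg (B : StarSubalgebra ℂ (Matrix N N ℂ)) {D : Matrix N N ℂ}
    (hD : D.IsHermitian) (hDB : D ∈ B)
    (h : ∀ a ∈ B, a.PosSemidef → 0 ≤ ((D * a).trace).re) : D.PosSemidef := by
  -- Test `D` against its own negative part: the trace is minus the sum of the squares of the
  -- negative eigenvalues, so none can occur.
  have hmem := cfc_mem_starSubalgebra B (fun x => max (-x) 0) hD hDB
  obtain ⟨U, hU, a, rfl⟩ := exists_unitaryDiag_of_isHermitian hD
  rw [cfc_unitaryDiag hU] at hmem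
  have h1 := h _ hmem (posSemidef_unitaryDiag U fun i => le_max_right _ _)
  rw [unitaryDiag_mul hU] at h1
  have h2 : ∀ c : N → ℝ, ((unitaryDiag U c).trace).re = ∑ i, c i := by
    intro c
    rw [unitaryDiag, mul_assoc, trace_mul_comm, mul_assoc, Unitary.star_mul_self_of_mem hU, mul_one]
    simp
  rw [h2] at h1
  have h3 : ∀ i, a i * max (-a i) 0 ≤ 0 := fun i => by
    rcases le_total 0 (a i) with hi | hi
    · rw [max_eq_right (by linarith)]; simp
    · exact mul_nonpos_of_nonpos_of_nonneg hi (le_max_right _ _)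
  have h4 := (Finset.sum_eq_zero_iff_of_nonpos fun i _ => h3 i).1
    (le_antisymm (Finset.sum_nonpos fun i _ => h3 i) h1)
  refine posSemidef_unitaryDiag U fun i => ?_
  by_contra hi
  push Not at hi
  have := h4 i (Finset.mem_univ i)
  rw [max_eq_left (by linarith)] at this
  nlinarith

theorem exists_star_mul_self (B : StarSubalgebra ℂ (Matrix N N ℂ)) {a : Matrix N N ℂ}
    (haB : a ∈ B) (ha : a.PosSemidef) : ∃ b ∈ B, a = star b * b := by
  refine ⟨cfc Real.sqrt a, cfc_mem_starSubalgebra B _ ha.1 haB, ?_⟩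
  obtain ⟨U, hU, c, hc, rfl⟩ := exists_unitaryDiag ha
  rw [cfc_unitaryDiag hU]
  have : star (unitaryDiag U fun i => √(c i)) = unitaryDiag U fun i => √(c i) :=
    isHermitian_unitaryDiag U _
  rw [this, unitaryDiag_mul hU]
  simp [Real.mul_self_sqrt (hc _)]

/-- The inequality of Audenaert et al., with the optimal test. -/
theorem exists_test_le_trace_suppPow (B : StarSubalgebra ℂ (Matrix N N ℂ)) {R S : Matrix N N ℂ}
    (hR : R.PosSemidef) (hS : S.PosSemidef) (hRB : R ∈ B) (hSB : S ∈ B) {t : ℝ}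
    (ht : t ∈ Icc (0 : ℝ) 1) :
    ∃ a ∈ B, a.PosSemidef ∧ (1 - a).PosSemidef ∧
      ((R * (1 - a)).trace).re + ((S * a).trace).re ≤
        ((suppPow R (1 - t) * suppPow S t).trace).re := by
  have hH : (R - S).IsHermitian := hR.1.sub hS.1
  have hmem := cfc_mem_starSubalgebra B (fun x => if 0 < x then 1 else 0) hH (sub_mem hRB hSB)
  obtain ⟨U, hU, c, hc⟩ := exists_unitaryDiag_of_isHermitian hH
  rw [hc, cfc_unitaryDiag hU] at hmem
  refine ⟨_, hmem, posSemidef_unitaryDiag U fun i => by split_ifs <;> norm_num, ?_, ?_⟩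
  · rw [← unitaryDiag_one hU, unitaryDiag_sub]
    exact posSemidef_unitaryDiag U fun i => by split_ifs <;> norm_num
  -- `P` projects onto the positive part of `R - S`, and `Δ` is that positive part. Then `S + Δ`
  -- dominates both `R` and `S`, and the error of `P` is Tr R - Tr Δ.
  set P := unitaryDiag U fun i => if 0 < c i then 1 else 0 with hP
  set Δ := unitaryDiag U fun i => max (c i) 0 with hΔ
  have hΔP : (R - S) * P = Δ := by
    rw [hc, hP, unitaryDiag_mul hU, hΔ]
    congr 1
    funext i
    split_ifs with h
    · rw [max_eq_left h.le, mul_one]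
    · rw [max_eq_right (not_lt.1 h), mul_zero]
  have hΔ0 : Δ.PosSemidef := posSemidef_unitaryDiag U fun i => le_max_right _ _
  have hRle : R ≤ S + Δ := by
    rw [Matrix.le_iff]
    have : S + Δ - R = Δ - (R - S) := by abel
    rw [this, hc, hΔ, unitaryDiag_sub]
    exact posSemidef_unitaryDiag U fun i => sub_nonneg.2 (le_max_left _ _)
  have hSle : S ≤ S + Δ := by
    rw [Matrix.le_iff, add_sub_cancel_left]
    exact hΔ0
  have hQ : (S + Δ).PosSemidef := hS.add hΔ0
  have ht' : 1 - t ∈ Icc (0 : ℝ) 1 := ⟨by linarith [ht.2], by linarith [ht.1]⟩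
  have e1 : ((R * (1 - P)).trace).re + ((S * P).trace).re = R.trace.re - Δ.trace.re := by
    rw [← hΔP]
    simp only [mul_sub, sub_mul, mul_one, trace_sub, Complex.sub_re]
    ring
  have e2 := congrArg (fun X => (trace X).re) (suppPow_mul_suppPow hR t)
  have e3 := congrArg (fun X => (trace X).re) (suppPow_mul_suppPow hQ t)
  have e4 := congrArg (fun X => (trace X).re) (suppPow_mul_suppPow hS t)
  simp only [trace_add, Complex.add_re] at e3
  have i1 := trace_mul_re_nonneg (Matrix.le_iff.1 (suppPow_mono hR hRle ht'))
    (Matrix.le_iff.1 (suppPow_mono hS hSle ht))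
  have i2 := trace_mul_re_nonneg (Matrix.le_iff.1 (suppPow_mono hR hRle ht'))
    (Matrix.le_iff.1 (suppPow_mono hR hRle ht))
  have i3 := trace_mul_re_nonneg (Matrix.le_iff.1 (suppPow_mono hS hSle ht'))
    (suppPow_posSemidef hS t)
  have i4 := trace_mul_re_nonneg (suppPow_posSemidef hR (1 - t))
    (Matrix.le_iff.1 (suppPow_mono hR hRle ht))
  simp only [mul_sub, sub_mul, trace_sub, Complex.sub_re] at i1 i2 i3 i4
  rw [e1]
  linarith

/-! ### A lower bound for the error of every test -/

/-- T - T² = T(1-T)T + (1-T)T(1-T). Replacing a test by its square can only lower the error, and it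
makes the error a sum of squared matrix entries. -/
theorem posSemidef_sub_mul_self {T : Matrix N N ℂ} (hT : T.PosSemidef)
    (hT1 : (1 - T).PosSemidef) : (T - T * Tᴴ).PosSemidef := by
  have h1 := hT1.mul_mul_conjTranspose_same T
  have h2 := hT.mul_mul_conjTranspose_same (1 - T)
  have e : T - T * Tᴴ = T * (1 - T) * Tᴴ + (1 - T) * T * (1 - T)ᴴ := by
    rw [hT1.1.eq, hT.1.eq]
    noncomm_ring
  rw [e]
  exact h1.add h2

/-- Inserting V V* = 1 between `S` and `Sᴴ` allows any second orthonormal basis, in particular the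
eigenbasis of the other state. -/
theorem trace_unitaryDiag_mul_mul_conjTranspose (U : Matrix N N ℂ) {V : Matrix N N ℂ}
    (hV : V ∈ unitary (Matrix N N ℂ)) (a : N → ℝ) (S : Matrix N N ℂ) :
    ((unitaryDiag U a * (S * Sᴴ)).trace).re =
      ∑ i, ∑ j, a i * ‖(star U * S * V) i j‖ ^ 2 := by
  have e : (unitaryDiag U a * (S * Sᴴ)).trace =
      (diagonal (fun i => (a i : ℂ)) * ((star U * S * V) * (star U * S * V)ᴴ)).trace := by
    have h : V * star V = 1 := Unitary.mul_star_self_of_mem hV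
    have h2 : (star U * S * V) * (star U * S * V)ᴴ = star U * (S * Sᴴ) * U := by
      calc (star U * S * V) * (star U * S * V)ᴴ = star U * S * (V * star V) * Sᴴ * U := by
            simp only [conjTranspose_mul, mul_assoc, star_eq_conjTranspose,
              conjTranspose_conjTranspose]
        _ = _ := by rw [h]; simp only [mul_one, mul_assoc]
    rw [h2, unitaryDiag, mul_assoc, mul_assoc, trace_mul_comm]
    simp only [mul_assoc]
  rw [e, trace, Complex.re_sum]
  refine Finset.sum_congr rfl fun i _ => ?_
  rw [diag_apply, diagonal_mul, mul_apply, Complex.re_ofReal_mul, Complex.re_sum, Finset.mul_sum]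
  refine Finset.sum_congr rfl fun j _ => ?_
  rw [conjTranspose_apply, Complex.star_def, Complex.mul_conj, Complex.ofReal_re,
    Complex.normSq_eq_norm_sq]

/-- The bound of Nussbaum and Szkoła. -/
theorem half_sum_min_le_error {U V : Matrix N N ℂ} (hU : U ∈ unitary (Matrix N N ℂ))
    (hV : V ∈ unitary (Matrix N N ℂ)) {a b : N → ℝ} (ha : ∀ i, 0 ≤ a i) (hb : ∀ i, 0 ≤ b i)
    {T : Matrix N N ℂ} (hT : T.PosSemidef) (hT1 : (1 - T).PosSemidef) :
    (∑ i, ∑ j, min (a i) (b j) * ‖(star U * V) i j‖ ^ 2) / 2 ≤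
      ((unitaryDiag U a * (1 - T)).trace).re + ((unitaryDiag V b * T).trace).re := by
  have h1 := trace_mul_re_nonneg (posSemidef_unitaryDiag U ha)
    (posSemidef_sub_mul_self hT1 (by simpa using hT))
  have h2 := trace_mul_re_nonneg (posSemidef_unitaryDiag V hb) (posSemidef_sub_mul_self hT hT1)
  rw [mul_sub, trace_sub, Complex.sub_re] at h1 h2
  rw [trace_unitaryDiag_mul_mul_conjTranspose U hV] at h1
  rw [trace_unitaryDiag_mul_mul_conjTranspose V hU] at h2
  have e2 : ∑ j, ∑ i, b j * ‖(star V * T * U) j i‖ ^ 2 =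
      ∑ i, ∑ j, b j * ‖(star U * T * V) i j‖ ^ 2 := by
    rw [Finset.sum_comm]
    refine Finset.sum_congr rfl fun i _ => Finset.sum_congr rfl fun j _ => ?_
    have : star V * T * U = (star U * T * V)ᴴ := by
      simp only [conjTranspose_mul, star_eq_conjTranspose, conjTranspose_conjTranspose, hT.1.eq,
        mul_assoc]
    rw [this, conjTranspose_apply, norm_star]
  have h3 : (∑ i, ∑ j, min (a i) (b j) * ‖(star U * V) i j‖ ^ 2) / 2 ≤
      ∑ i, ∑ j, a i * ‖(star U * (1 - T) * V) i j‖ ^ 2 +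
        ∑ i, ∑ j, b j * ‖(star U * T * V) i j‖ ^ 2 := by
    simp only [Finset.sum_div, ← Finset.sum_add_distrib]
    refine Finset.sum_le_sum fun i _ => Finset.sum_le_sum fun j _ => ?_
    -- Each overlap splits into the entries of 1 - T and T. By |x + y|² ≤ 2(|x|² + |y|²) these
    -- cannot both be small; this is where the factor 1/2 comes from.
    have e : (star U * V) i j = (star U * (1 - T) * V) i j + (star U * T * V) i j := by
      rw [← Matrix.add_apply, ← add_mul, ← mul_add, sub_add_cancel, mul_one]
    have hn := norm_add_le ((star U * (1 - T) * V) i j) ((star U * T * V) i j)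
    rw [← e] at hn
    set x := ‖(star U * (1 - T) * V) i j‖
    set y := ‖(star U * T * V) i j‖
    set z := ‖(star U * V) i j‖
    have hz : z ^ 2 ≤ 2 * (x ^ 2 + y ^ 2) := by
      have hz0 : 0 ≤ z := norm_nonneg _
      nlinarith [sq_nonneg (x - y)]
    have hm : 0 ≤ min (a i) (b j) := le_min (ha i) (hb j)
    have l1 := mul_le_mul_of_nonneg_right (min_le_left (a i) (b j)) (sq_nonneg x)
    have l2 := mul_le_mul_of_nonneg_right (min_le_right (a i) (b j)) (sq_nonneg y)
    nlinarith [mul_le_mul_of_nonneg_left hz hm]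
  linarith

end Tests

/-! ### Classical testing of independent samples -/

section Classical

variable {X : Type*} [Fintype X]

theorem sum_prod_eq_one {r : X → ℝ} (hr : ∑ x, r x = 1) (k : ℕ) :
    ∑ x : Fin k → X, ∏ i, r (x i) = 1 := by
  classical
  rw [← Fintype.sum_pow, hr, one_pow]

/-- The variance of a sum of independent centred variables. The offset `c` absorbs the first sample
in the induction on `k`. -/
theorem sum_prod_mul_sq {r ℓ : X → ℝ} (hr : ∑ x, r x = 1) (hℓ : ∑ x, r x * ℓ x = 0) (k : ℕ)
    (c : ℝ) : ∑ x : Fin k → X, (∏ i, r (x i)) * (c + ∑ i, ℓ (x i)) ^ 2 =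
      c ^ 2 + k * ∑ x, r x * ℓ x ^ 2 := by
  induction k generalizing c with
  | zero => simp
  | succ k ih =>
    rw [← (Fin.consEquiv fun _ => X).sum_comp, Fintype.sum_prod_type]
    have h : ∀ y : X, ∑ x : Fin k → X,
        (∏ i, r ((Fin.consEquiv fun _ => X) (y, x) i)) *
          (c + ∑ i, ℓ ((Fin.consEquiv fun _ => X) (y, x) i)) ^ 2 =
        c ^ 2 * r y + 2 * c * (r y * ℓ y) + r y * ℓ y ^ 2 +
          (k * ∑ x, r x * ℓ x ^ 2) * r y := by
      intro y
      have := ih (c + ℓ y)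
      simp only [Fin.consEquiv_apply, Fin.prod_univ_succ, Fin.sum_univ_succ, Fin.cons_zero,
        Fin.cons_succ, ← add_assoc, mul_assoc, ← Finset.mul_sum, this]
      ring
    simp only [h, Finset.sum_add_distrib, ← Finset.mul_sum, hr, hℓ]
    push_cast
    ring

theorem exp_neg_sum_le {Ω : Type*} [Fintype Ω] {R Z : Ω → ℝ} (hR : ∀ x, 0 ≤ R x)
    (hR1 : ∑ x, R x = 1) :
    Real.exp (-∑ x, R x * Z x) ≤ ∑ x, R x * Real.exp (-Z x) := by
  have := (convexOn_exp).map_sum_le (t := Finset.univ) (w := R) (p := fun x => -Z x)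
    (fun i _ => hR i) hR1 (fun _ _ => mem_univ _)
  simpa [smul_eq_mul] using this

/-- A lower bound on the error of the optimal classical test for independent samples. -/
theorem exists_exponent_of_pos [Nonempty X] {p L : X → ℝ} (hp : ∀ x, 0 < p x) :
    ∃ t ∈ Icc (0 : ℝ) 1, ∃ C : ℝ, ∀ k : ℕ,
      (∑ x, p x * Real.exp (t * L x)) ^ k * Real.exp (-(C * √k)) ≤
        ∑ x : Fin k → X, min (∏ i, p (x i)) (∏ i, p (x i) * Real.exp (L (x i))) := by
  set g : ℝ → ℝ := fun t => ∑ x, p x * Real.exp (t * L x) with hg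
  have hgc : Continuous g := by fun_prop
  obtain ⟨t, ht, hmin⟩ := isCompact_Icc.exists_isMinOn (nonempty_Icc.2 zero_le_one)
    hgc.continuousOn
  have hgpos : 0 < g t := Finset.sum_pos (fun x _ => mul_pos (hp x) (Real.exp_pos _))
    Finset.univ_nonempty
  -- Exponential tilting of `p` at the minimizer of g(t) = ∑ p^(1-t) q^t, where q = p e^L; its mean
  -- `m` of `L` is the logarithmic derivative of `g` at `t`.
  set r : X → ℝ := fun x => p x * Real.exp (t * L x) / g t with hr
  have hr0 : ∀ x, 0 ≤ r x := fun x =>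
    div_nonneg (mul_nonneg (hp x).le (Real.exp_pos _).le) hgpos.le
  have hr1 : ∑ x, r x = 1 := by
    rw [hr, ← Finset.sum_div]
    exact div_self hgpos.ne'
  set m : ℝ := ∑ x, r x * L x with hm
  have hderiv : HasDerivAt g (g t * m) t := by
    have h1 : HasDerivAt g (∑ x, p x * (Real.exp (t * L x) * L x)) t := by
      refine HasDerivAt.fun_sum fun x _ => HasDerivAt.const_mul _ ?_
      simpa using ((hasDerivAt_id t).mul_const (L x)).exp
    convert h1 using 1
    rw [hm, Finset.mul_sum]
    refine Finset.sum_congr rfl fun x _ => ?_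
    rw [hr]
    field_simp
  -- First-order condition at a minimum over an interval, endpoints included. Only s = 0 and s = 1
  -- are used: -t m ≥ 0 and (1 - t) m ≥ 0.
  have hfirst : ∀ s ∈ Icc (0 : ℝ) 1, 0 ≤ (s - t) * m := by
    intro s hs
    have h1 := (hmin.localize).hasFDerivWithinAt_nonneg
      hderiv.hasFDerivAt.hasFDerivWithinAt (y := s - t)
      (sub_mem_posTangentConeAt_of_segment_subset
        ((convex_Icc 0 1).segment_subset ht hs))
    have h2 : 0 ≤ (s - t) * (g t * m) := by simpa using h1
    have h3 : (s - t) * (g t * m) = g t * ((s - t) * m) := by ring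
    rw [h3] at h2
    exact nonneg_of_mul_nonneg_right h2 hgpos
  have hm0 := hfirst 0 ⟨le_rfl, zero_le_one⟩
  have hm1 := hfirst 1 ⟨zero_le_one, le_rfl⟩
  set ℓ : X → ℝ := fun x => L x - m with hℓ
  have hℓ0 : ∑ x, r x * ℓ x = 0 := by
    simp only [hℓ, mul_sub, Finset.sum_sub_distrib, ← Finset.sum_mul, hr1]
    rw [← hm]
    ring
  set V : ℝ := ∑ x, r x * ℓ x ^ 2 with hV
  refine ⟨t, ht, (V + 1) / 2, fun k => ?_⟩
  have hR0 : ∀ x : Fin k → X, 0 ≤ ∏ i, r (x i) := fun x => Finset.prod_nonneg fun i _ => hr0 _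
  -- By the arithmetic–geometric mean inequality `Z` dominates |∑ ℓ|. Unlike the modulus, its mean
  -- is explicit: the second moment k V gives (V + 1)√k / 2.
  set Z : (Fin k → X) → ℝ := fun x => ((∑ i, ℓ (x i)) ^ 2 / √k + √k) / 2 with hZ
  have hZsum : ∑ x : Fin k → X, (∏ i, r (x i)) * Z x = (V + 1) / 2 * √k := by
    have h2 := sum_prod_mul_sq hr1 hℓ0 k 0
    simp only [zero_add] at h2
    have h3 : ∀ x : Fin k → X, (∏ i, r (x i)) * Z x =
        ((∏ i, r (x i)) * (∑ i, ℓ (x i)) ^ 2) * (1 / (2 * √k)) + (∏ i, r (x i)) * (√k / 2) := by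
      intro x
      rw [hZ]
      ring
    simp only [h3, Finset.sum_add_distrib, ← Finset.sum_mul, h2, sum_prod_eq_one hr1]
    rcases Nat.eq_zero_or_pos k with rfl | hk
    · simp
    have hk' : (0 : ℝ) < √k := Real.sqrt_pos.2 (by exact_mod_cast hk)
    have hk2 : √(k : ℝ) ^ 2 = k := Real.sq_sqrt (by positivity)
    rw [← hV]
    field_simp
    rw [hk2]
    ring
  have hJ := exp_neg_sum_le (Z := Z) hR0 (sum_prod_eq_one hr1 k)
  rw [hZsum] at hJ
  calc g t ^ k * Real.exp (-((V + 1) / 2 * √k))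
      ≤ g t ^ k * ∑ x : Fin k → X, (∏ i, r (x i)) * Real.exp (-Z x) :=
        mul_le_mul_of_nonneg_left hJ (by positivity)
    _ ≤ _ := ?_
  rw [Finset.mul_sum]
  refine Finset.sum_le_sum fun x _ => ?_
  have hY : |∑ i, ℓ (x i)| ≤ Z x := by
    rcases Nat.eq_zero_or_pos k with rfl | hk
    · simp [hZ]
    have hk' : (0 : ℝ) < √k := Real.sqrt_pos.2 (by exact_mod_cast hk)
    rw [hZ]
    dsimp only
    rw [le_div_iff₀ two_pos, div_add' _ _ _ hk'.ne', le_div_iff₀ hk', ← sq_abs]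
    nlinarith [sq_nonneg (|∑ i, ℓ (x i)| - √k)]
  set S : ℝ := ∑ i, L (x i) with hS
  have hYS : ∑ i, ℓ (x i) = S - k * m := by
    simp [hℓ, Finset.sum_sub_distrib, hS]
  -- The products of p and q are g^k R times e^(-tS) and e^((1-t)S). With S = k m + ∑ ℓ, the
  -- first-order condition bounds both exponents below by -|∑ ℓ|, hence by -Z.
  have hRx : g t ^ k * ∏ i, r (x i) = (∏ i, p (x i)) * Real.exp (t * S) := by
    simp only [hr, Finset.prod_div_distrib, Finset.prod_const, Finset.card_univ, Fintype.card_fin,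
      Finset.prod_mul_distrib, ← Real.exp_sum, ← Finset.mul_sum, ← hS]
    field_simp
  have hP : 0 < ∏ i, p (x i) := Finset.prod_pos fun i _ => hp _
  rw [← mul_assoc, hRx, mul_assoc, ← Real.exp_add, Finset.prod_mul_distrib, ← Real.exp_sum, ← hS]
  have hk0 : (0 : ℝ) ≤ k := Nat.cast_nonneg k
  have hab1 := neg_abs_le (∑ i, ℓ (x i))
  have hab2 := le_abs_self (∑ i, ℓ (x i))
  rw [hYS] at hY hab1 hab2
  have ha0 := abs_nonneg (S - k * m)
  have hkm0 := mul_nonneg hk0 hm0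
  have hkm1 := mul_nonneg hk0 hm1
  refine le_min ?_ ?_
  · refine mul_le_of_le_one_right hP.le (Real.exp_le_one_iff.2 ?_)
    have : t * (S - k * m) ≤ 1 * |S - k * m| := by
      refine (mul_le_mul_of_nonneg_left hab2 ht.1).trans ?_
      exact mul_le_mul_of_nonneg_right ht.2 ha0
    nlinarith
  · refine mul_le_mul_of_nonneg_left (Real.exp_le_exp.2 ?_) hP.le
    have : -(1 * |S - k * m|) ≤ (1 - t) * (S - k * m) := by
      have h1 := mul_le_mul_of_nonneg_left hab1 (sub_nonneg.2 ht.2)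
      have h2 := mul_le_mul_of_nonneg_right (by linarith [ht.1] : 1 - t ≤ 1) ha0
      linarith
    nlinarith

/-- Restrict to the common support of `p` and `q`, where q = p exp(log q - log p). The discarded
atoms add nothing on the left and only nonnegative terms on the right. -/
theorem exists_exponent {p q : X → ℝ} (hp : ∀ x, 0 ≤ p x) (hq : ∀ x, 0 ≤ q x) :
    ∃ t ∈ Icc (0 : ℝ) 1, ∃ C : ℝ, ∀ k : ℕ,
      (∑ x, if p x = 0 ∨ q x = 0 then 0 else p x ^ (1 - t) * q x ^ t) ^ k *
          Real.exp (-(C * √k)) ≤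
        ∑ x : Fin k → X, min (∏ i, p (x i)) (∏ i, q (x i)) := by
  classical
  let Y := {x : X // ¬ (p x = 0 ∨ q x = 0)}
  have hpY : ∀ y : Y, 0 < p y := fun y =>
    lt_of_le_of_ne (hp _) fun h => y.2 (Or.inl h.symm)
  have hqY : ∀ y : Y, 0 < q y := fun y =>
    lt_of_le_of_ne (hq _) fun h => y.2 (Or.inr h.symm)
  have hsum : ∀ t, (∑ x, if p x = 0 ∨ q x = 0 then 0 else p x ^ (1 - t) * q x ^ t) =
      ∑ y : Y, p y * Real.exp (t * (Real.log (q y) - Real.log (p y))) := by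
    intro t
    simp_rw [← ite_not (p _ = 0 ∨ q _ = 0)]
    rw [← Finset.sum_filter, Finset.sum_subtype (p := fun x => ¬ (p x = 0 ∨ q x = 0)) _ (by simp)]
    refine Finset.sum_congr rfl fun y _ => ?_
    rw [Real.rpow_def_of_pos (hpY y), Real.rpow_def_of_pos (hqY y), ← Real.exp_add]
    nth_rewrite 2 [← Real.exp_log (hpY y)]
    rw [← Real.exp_add]
    ring_nf
  have hle : ∀ k, ∑ y : Fin k → Y, min (∏ i, p (y i)) (∏ i, q (y i)) ≤
      ∑ x : Fin k → X, min (∏ i, p (x i)) (∏ i, q (x i)) := by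
    intro k
    have hinj : Function.Injective fun (y : Fin k → Y) i => (y i : X) := fun y z h => by
      funext i
      exact Subtype.ext (congrFun h i)
    have hmap := Finset.sum_map Finset.univ ⟨_, hinj⟩
      (fun x : Fin k → X => min (∏ i, p (x i)) (∏ i, q (x i)))
    refine (le_of_eq hmap.symm).trans ?_
    exact Finset.sum_le_sum_of_subset_of_nonneg (Finset.subset_univ _) fun x _ _ =>
      le_min (Finset.prod_nonneg fun i _ => hp _) (Finset.prod_nonneg fun i _ => hq _)
  rcases isEmpty_or_nonempty Y with hY | hY
  · refine ⟨0, ⟨le_rfl, zero_le_one⟩, 0, fun k => ?_⟩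
    refine le_trans ?_ (hle k)
    rw [hsum]
    -- With empty common support the left side is 0 ^ k, which equals 1 at `k = 0`; there the right
    -- side is the single empty product.
    rcases Nat.eq_zero_or_pos k with rfl | hk
    · simp
    · have := hk.ne'
      rw [Finset.univ_eq_empty, Finset.sum_empty, zero_pow this, zero_mul]
      exact Finset.sum_nonneg fun y _ => le_min (Finset.prod_nonneg fun i _ => hp _)
        (Finset.prod_nonneg fun i _ => hq _)
  · obtain ⟨t, ht, C, h⟩ := exists_exponent_of_pos (X := Y) (p := fun y => p y)
      (L := fun y => Real.log (q y) - Real.log (p y)) hpY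
    refine ⟨t, ht, C, fun k => ?_⟩
    rw [hsum]
    refine (h k).trans (le_trans (le_of_eq ?_) (hle k))
    refine Finset.sum_congr rfl fun y _ => ?_
    congr 1
    refine Finset.prod_congr rfl fun i _ => ?_
    rw [Real.exp_sub, Real.exp_log (hqY _), Real.exp_log (hpY _)]
    field_simp [(hpY (y i)).ne']

end Classical

/-! ### Tensor powers, appending a site and the partial trace -/

section TensorPowers

open Matrix
open scoped MatrixOrder

variable {d : Type*} [Fintype d] [DecidableEq d]

theorem elemTensor_mul {n : ℕ} (a b : Fin n → Matrix d d ℂ) :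
    elemTensor a * elemTensor b = elemTensor fun i => a i * b i := by
  ext x y
  simp only [elemTensor, mul_apply, of_apply, ← Finset.prod_mul_distrib]
  rw [Finset.prod_univ_sum, Fintype.piFinset_univ]

theorem elemTensor_one {n : ℕ} :
    elemTensor (fun _ : Fin n => (1 : Matrix d d ℂ)) = 1 := by
  ext x y
  simp only [elemTensor, of_apply, one_apply, Finset.prod_ite_zero, Finset.prod_const_one,
    Finset.mem_univ, forall_const, funext_iff]

theorem star_elemTensor {n : ℕ} (a : Fin n → Matrix d d ℂ) :
    star (elemTensor a) = elemTensor fun i => star (a i) := by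
  ext x y
  simp [elemTensor, star_apply, star_prod]

/-- Elementary tensors are closed under products and adjoints and contain 1, so the algebra they
generate is their span. Membership can then be checked on elementary tensors. -/
theorem tensorAlg_eq_span (𝒜 : StarSubalgebra ℂ (Matrix d d ℂ)) (n : ℕ) :
    Subalgebra.toSubmodule (tensorAlg 𝒜 n).toSubalgebra = Submodule.span ℂ
      {M | ∃ a : Fin n → Matrix d d ℂ, (∀ i, a i ∈ 𝒜) ∧ M = elemTensor a} := by
  set s := {M | ∃ a : Fin n → Matrix d d ℂ, (∀ i, a i ∈ 𝒜) ∧ M = elemTensor a} with hs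
  have hstar : star s ⊆ s := by
    rintro M ⟨a, ha, hM⟩
    refine ⟨fun i => star (a i), fun i => star_mem (ha i), ?_⟩
    rw [← star_elemTensor, ← hM, star_star]
  have h1 : (tensorAlg 𝒜 n).toSubalgebra = Algebra.adjoin ℂ s := by
    rw [tensorAlg, StarAlgebra.adjoin_toSubalgebra, union_eq_self_of_subset_right hstar]
  let S : Submonoid (Matrix (Fin n → d) (Fin n → d) ℂ) :=
    { carrier := s
      one_mem' := ⟨_, fun _ => one_mem 𝒜, elemTensor_one.symm⟩
      mul_mem' := by
        rintro _ _ ⟨a, ha, rfl⟩ ⟨b, hb, rfl⟩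
        exact ⟨_, fun i => mul_mem (ha i) (hb i), elemTensor_mul a b⟩ }
  rw [h1, Algebra.adjoin_eq_span]
  congr 1
  exact congrArg _ (Submonoid.closure_eq S)

theorem elemTensor_mem {𝒜 : StarSubalgebra ℂ (Matrix d d ℂ)} {n : ℕ} {a : Fin n → Matrix d d ℂ}
    (ha : ∀ i, a i ∈ 𝒜) : elemTensor a ∈ tensorAlg 𝒜 n :=
  StarAlgebra.subset_adjoin ℂ _ ⟨a, ha, rfl⟩

theorem exists_sum_elemTensor {𝒜 : StarSubalgebra ℂ (Matrix d d ℂ)} {n : ℕ}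
    {M : Matrix (Fin n → d) (Fin n → d) ℂ} (hM : M ∈ tensorAlg 𝒜 n) :
    ∃ (r : ℕ) (c : Fin r → ℂ) (a : Fin r → Fin n → Matrix d d ℂ),
      (∀ j i, a j i ∈ 𝒜) ∧ M = ∑ j, c j • elemTensor (a j) := by
  have h : M ∈ Submodule.span ℂ
      {M | ∃ a : Fin n → Matrix d d ℂ, (∀ i, a i ∈ 𝒜) ∧ M = elemTensor a} := by
    rw [← tensorAlg_eq_span]
    exact hM
  obtain ⟨r, c, g, hg⟩ := Submodule.mem_span_set'.1 h
  choose a ha hga using fun j => (g j).2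
  exact ⟨r, c, a, ha, by rw [← hg]; simp only [hga]⟩

/-- Expand the power multilinearly into elementary tensors. Membership is needed because positivity
as a functional on the algebra controls only matrices that lie in it. -/
theorem tensorPow_mem {𝒜 : StarSubalgebra ℂ (Matrix d d ℂ)} (k : ℕ) {m : ℕ}
    {M : Matrix (Fin m → d) (Fin m → d) ℂ} (hM : M ∈ tensorAlg 𝒜 m) :
    tensorPow k M ∈ tensorAlg 𝒜 (k * m) := by
  obtain ⟨r, c, a, ha, rfl⟩ := exists_sum_elemTensor hM
  have h : tensorPow k (∑ j, c j • elemTensor (a j)) = ∑ J : Fin k → Fin r,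
      (∏ i, c (J i)) • elemTensor fun u : Fin (k * m) =>
        a (J (finProdFinEquiv.symm u).1) (finProdFinEquiv.symm u).2 := by
    ext x y
    simp only [tensorPow, of_apply, Matrix.sum_apply, Matrix.smul_apply, elemTensor, smul_eq_mul]
    rw [Finset.prod_univ_sum, Fintype.piFinset_univ]
    refine Finset.sum_congr rfl fun J _ => ?_
    rw [Finset.prod_mul_distrib, ← finProdFinEquiv.prod_comp, Fintype.prod_prod_type]
    simp only [Equiv.symm_apply_apply]
  rw [h]
  exact sum_mem fun J _ => SMulMemClass.smul_mem _ (elemTensor_mem fun u => ha _ _)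

/-- The configurations of `k` blocks of `m` sites. -/
def blocks (d : Type*) (k m : ℕ) : (Fin (k * m) → d) ≃ (Fin k → Fin m → d) :=
  (finProdFinEquiv.symm.arrowCongr (Equiv.refl d)).trans (Equiv.curry _ _ _)

theorem tensorPow_apply (k : ℕ) {m : ℕ} (M : Matrix (Fin m → d) (Fin m → d) ℂ)
    (x y : Fin (k * m) → d) :
    tensorPow k M x y = ∏ i, M (blocks d k m x i) (blocks d k m y i) := rfl

theorem tensorPow_mul (k : ℕ) {m : ℕ} (M M' : Matrix (Fin m → d) (Fin m → d) ℂ) :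
    tensorPow k (M * M') = tensorPow k M * tensorPow k M' := by
  ext x y
  simp only [tensorPow_apply, mul_apply, ← Finset.prod_mul_distrib]
  rw [Finset.prod_univ_sum, Fintype.piFinset_univ,
    (blocks d k m).sum_comp fun z : Fin k → Fin m → d =>
      ∏ i, M (blocks d k m x i) (z i) * M' (z i) (blocks d k m y i)]

theorem tensorPow_one (k : ℕ) {m : ℕ} :
    tensorPow k (1 : Matrix (Fin m → d) (Fin m → d) ℂ) = 1 := by
  ext x y
  simp only [tensorPow_apply, one_apply, Finset.prod_ite_zero, Finset.prod_const_one,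
    Finset.mem_univ, forall_const, ← (blocks d k m).injective.eq_iff, funext_iff]

theorem star_tensorPow (k : ℕ) {m : ℕ} (M : Matrix (Fin m → d) (Fin m → d) ℂ) :
    star (tensorPow k M) = tensorPow k (star M) := by
  ext x y
  simp [tensorPow_apply, star_apply, star_prod]

theorem trace_tensorPow (k : ℕ) {m : ℕ} (M : Matrix (Fin m → d) (Fin m → d) ℂ) :
    (tensorPow k M).trace = M.trace ^ k := by
  simp only [trace, diag_apply, tensorPow_apply]
  rw [(blocks d k m).sum_comp fun z : Fin k → Fin m → d => ∏ i, M (z i) (z i), Fintype.sum_pow]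

theorem tensorPow_mem_unitary (k : ℕ) {m : ℕ} {U : Matrix (Fin m → d) (Fin m → d) ℂ}
    (hU : U ∈ unitary (Matrix (Fin m → d) (Fin m → d) ℂ)) :
    tensorPow k U ∈ unitary (Matrix (Fin (k * m) → d) (Fin (k * m) → d) ℂ) := by
  rw [Unitary.mem_iff, star_tensorPow, ← tensorPow_mul, ← tensorPow_mul,
    Unitary.star_mul_self_of_mem hU, Unitary.mul_star_self_of_mem hU, tensorPow_one]
  exact ⟨rfl, rfl⟩

theorem tensorPow_unitaryDiag (k : ℕ) {m : ℕ} (U : Matrix (Fin m → d) (Fin m → d) ℂ)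
    (a : (Fin m → d) → ℝ) : tensorPow k (unitaryDiag U a) =
      unitaryDiag (tensorPow k U) fun x => ∏ i, a (blocks d k m x i) := by
  rw [unitaryDiag, tensorPow_mul, tensorPow_mul, ← star_tensorPow, unitaryDiag]
  congr 2
  ext x y
  simp only [tensorPow_apply, diagonal_apply, Finset.prod_ite_zero, Finset.mem_univ, forall_const,
    ← (blocks d k m).injective.eq_iff, funext_iff]
  push_cast
  rfl

theorem suppPow_tensorPow (k : ℕ) {m : ℕ} {M : Matrix (Fin m → d) (Fin m → d) ℂ}
    (hM : M.PosSemidef) (t : ℝ) : suppPow (tensorPow k M) t = tensorPow k (suppPow M t) := by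
  obtain ⟨U, hU, a, ha, rfl⟩ := exists_unitaryDiag hM
  rw [suppPow_unitaryDiag hU, tensorPow_unitaryDiag, tensorPow_unitaryDiag,
    suppPow_unitaryDiag (tensorPow_mem_unitary k hU)]
  congr 1
  funext x
  -- A product of eigenvalues vanishes exactly when a factor does, so the support convention is
  -- multiplicative.
  simp only [Finset.prod_eq_zero_iff, Finset.mem_univ, true_and]
  split_ifs with h
  · obtain ⟨i, hi⟩ := h
    exact (Finset.prod_eq_zero (Finset.mem_univ i) (by simp [hi])).symm
  · push Not at h
    rw [← Real.finsetProd_rpow _ _ fun i _ => ha _]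
    exact Finset.prod_congr rfl fun i _ => by simp [h i]

theorem tensorPow_posSemidef (k : ℕ) {m : ℕ} {M : Matrix (Fin m → d) (Fin m → d) ℂ}
    (hM : M.PosSemidef) : (tensorPow k M).PosSemidef := by
  obtain ⟨U, hU, a, ha, rfl⟩ := exists_unitaryDiag hM
  rw [tensorPow_unitaryDiag]
  exact posSemidef_unitaryDiag _ fun x => Finset.prod_nonneg fun i _ => ha _

/-! ### Appending one site -/

theorem sum_snoc {E : Type*} [AddCommMonoid E] {n : ℕ} (f : (Fin (n + 1) → d) → E) :
    ∑ x, f x = ∑ x : Fin n → d, ∑ k : d, f (Fin.snoc x k) := by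
  rw [← (Fin.snocEquiv fun _ => d).sum_comp, Fintype.sum_prod_type, Finset.sum_comm]
  rfl

/-- The embedding `M ↦ M ⊗ 1` of the matrices on `n` sites into those on `n + 1` sites. -/
def appendOne (n : ℕ) : Matrix (Fin n → d) (Fin n → d) ℂ →⋆ₐ[ℂ]
    Matrix (Fin (n + 1) → d) (Fin (n + 1) → d) ℂ where
  toFun M := Matrix.of fun x y => M (Fin.init x) (Fin.init y) *
    (1 : Matrix d d ℂ) (x (Fin.last n)) (y (Fin.last n))
  map_one' := by
    ext x y
    rw [of_apply, ← Fin.snoc_init_self x, ← Fin.snoc_init_self y]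
    simp only [Fin.init_snoc, Fin.snoc_last, one_apply, Fin.snoc_inj]
    split_ifs <;> simp_all
  map_mul' M M' := by
    ext x y
    simp only [of_apply, mul_apply, sum_snoc, Fin.init_snoc, Finset.sum_mul]
    refine Finset.sum_congr rfl fun z _ => ?_
    simp only [one_apply]
    rw [Finset.sum_eq_single (x (Fin.last n))] <;> aesop
  map_zero' := by ext; simp
  map_add' M M' := by ext; simp [add_mul]
  commutes' c := by
    ext x y
    rw [of_apply, ← Fin.snoc_init_self x, ← Fin.snoc_init_self y]
    simp only [Fin.init_snoc, Fin.snoc_last, one_apply, Fin.snoc_inj, Matrix.algebraMap_matrix_apply]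
    split_ifs <;> simp_all
  map_star' M := by
    ext x y
    simp only [of_apply, star_apply, star_mul', one_apply, eq_comm]
    split_ifs <;> simp

theorem appendOne_apply {n : ℕ} (M : Matrix (Fin n → d) (Fin n → d) ℂ) (x y : Fin (n + 1) → d) :
    appendOne n M x y = M (Fin.init x) (Fin.init y) *
      (1 : Matrix d d ℂ) (x (Fin.last n)) (y (Fin.last n)) := rfl

theorem appendOne_mem {𝒜 : StarSubalgebra ℂ (Matrix d d ℂ)} {n : ℕ}
    {M : Matrix (Fin n → d) (Fin n → d) ℂ} (hM : M ∈ tensorAlg 𝒜 n) :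
    appendOne n M ∈ tensorAlg 𝒜 (n + 1) := by
  obtain ⟨r, c, a, ha, rfl⟩ := exists_sum_elemTensor hM
  rw [map_sum]
  refine sum_mem fun j _ => ?_
  rw [map_smul]
  refine SMulMemClass.smul_mem _ ?_
  have h : appendOne n (elemTensor (a j)) =
      elemTensor (Fin.snoc (a j) 1 : Fin (n + 1) → Matrix d d ℂ) := by
    ext x y
    rw [appendOne_apply, elemTensor, elemTensor, of_apply, of_apply, Fin.prod_univ_castSucc]
    simp only [Fin.snoc_castSucc, Fin.snoc_last]
    rfl
  rw [h]
  refine elemTensor_mem fun i => ?_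
  refine Fin.lastCases ?_ (fun i => ?_) i
  · simp [one_mem]
  · simpa using ha j i

theorem trace_appendOne {n : ℕ} (M : Matrix (Fin n → d) (Fin n → d) ℂ) :
    (appendOne n M).trace = Fintype.card d * M.trace := by
  simp [trace, sum_snoc, appendOne_apply, Finset.mul_sum]

/-- The sites 1, …, n are the first n of 1, …, n + 1, which makes the local restrictions of a state
consistent. -/
theorem place_appendOne {n : ℕ} (M : Matrix (Fin n → d) (Fin n → d) ℂ) :
    place (sites (n + 1)) (appendOne n M) = place (sites n) M := by
  ext ψ s
  change placeFun (sites (n + 1)) (appendOne n M) ψ s = placeFun (sites n) M ψ s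
  rw [placeFun_apply, placeFun_apply, sum_snoc]
  refine Finset.sum_congr rfl fun y _ => ?_
  have hlast : sites (n + 1) (Fin.last n) = (n : ℤ) + 1 := rfl
  rw [Finset.sum_eq_single (s (sites (n + 1) (Fin.last n)))]
  · rw [appendOne_apply, Fin.init_snoc, Fin.snoc_last]
    have h1 : Fin.init (s ∘ sites (n + 1)) = s ∘ sites n := rfl
    have h2 : Function.extend (sites (n + 1))
        (Fin.snoc y (s (sites (n + 1) (Fin.last n))) : Fin (n + 1) → d) s =
        Function.extend (sites n) y s := by
      funext z
      by_cases hz : ∃ i, sites (n + 1) i = z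
      · obtain ⟨i, rfl⟩ := hz
        rw [(sites (n + 1)).injective.extend_apply]
        refine Fin.lastCases ?_ (fun i => ?_) i
        · rw [Fin.snoc_last, Function.extend_apply']
          rintro ⟨j, hj⟩
          have : ((j : ℕ) : ℤ) + 1 = (n : ℤ) + 1 := hj
          omega
        · rw [Fin.snoc_castSucc]
          exact ((sites n).injective.extend_apply y s i).symm
      · rw [Function.extend_apply' _ _ _ hz, Function.extend_apply']
        rintro ⟨i, hi⟩
        exact hz ⟨i.castSucc, hi⟩
    rw [h1, h2, Function.comp_apply, one_apply_eq, mul_one]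
  · intro k _ hk
    rw [appendOne_apply, Fin.snoc_last, one_apply_ne, mul_zero, zero_mul]
    exact fun h => hk h.symm
  · simp

/-- The partial trace over the last site. -/
def ptrace {n : ℕ} (a : Matrix (Fin (n + 1) → d) (Fin (n + 1) → d) ℂ) :
    Matrix (Fin n → d) (Fin n → d) ℂ :=
  Matrix.of fun x y => ∑ k, a (Fin.snoc x k) (Fin.snoc y k)

theorem ptrace_mem {𝒜 : StarSubalgebra ℂ (Matrix d d ℂ)} {n : ℕ}
    {a : Matrix (Fin (n + 1) → d) (Fin (n + 1) → d) ℂ} (ha : a ∈ tensorAlg 𝒜 (n + 1)) :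
    ptrace a ∈ tensorAlg 𝒜 n := by
  obtain ⟨r, c, a, haA, rfl⟩ := exists_sum_elemTensor ha
  have h : ptrace (∑ j, c j • elemTensor (a j)) =
      ∑ j, (c j * (a j (Fin.last n)).trace) • elemTensor (Fin.init (a j)) := by
    ext x y
    simp only [ptrace, of_apply, Matrix.sum_apply, Matrix.smul_apply, elemTensor, smul_eq_mul,
      Fin.prod_univ_castSucc, Fin.snoc_castSucc, Fin.snoc_last]
    rw [Finset.sum_comm]
    refine Finset.sum_congr rfl fun j _ => ?_
    rw [← Finset.mul_sum, ← Finset.mul_sum, trace]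
    simp only [diag_apply, Fin.init]
    ring
  rw [h]
  exact sum_mem fun j _ => SMulMemClass.smul_mem _ (elemTensor_mem fun i => haA j i.castSucc)

theorem trace_appendOne_mul {n : ℕ} (M : Matrix (Fin n → d) (Fin n → d) ℂ)
    (a : Matrix (Fin (n + 1) → d) (Fin (n + 1) → d) ℂ) :
    (appendOne n M * a).trace = (M * ptrace a).trace := by
  simp only [trace, diag_apply, mul_apply, sum_snoc, appendOne_apply, Fin.init_snoc, Fin.snoc_last,
    ptrace, of_apply, Finset.mul_sum, one_apply]
  refine Finset.sum_congr rfl fun x _ => ?_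
  rw [Finset.sum_comm]
  refine Finset.sum_congr rfl fun y _ => Finset.sum_congr rfl fun k _ => ?_
  simp

/-- With J the all-ones matrix and D = dim · 1 - J, one has J² = dim · J and hence D* D = dim · D.
-/
theorem posSemidef_card_sub_ones :
    ((Fintype.card d : ℂ) • (1 : Matrix d d ℂ) - Matrix.of fun _ _ => 1).PosSemidef := by
  rcases isEmpty_or_nonempty d with hd | hd
  · convert PosSemidef.zero
    ext i
    exact hd.elim i
  set D := (Fintype.card d : ℂ) • (1 : Matrix d d ℂ) - Matrix.of fun _ _ => 1 with hD
  have hDH : Dᴴ = D := by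
    ext i j
    by_cases h : i = j
    · simp [hD, h]
    · simp [hD, h, Ne.symm h]
  have hc : (Fintype.card d : ℂ) ≠ 0 := by simp
  have h : D = ((Fintype.card d : ℂ))⁻¹ • (Dᴴ * D) := by
    rw [hDH, eq_inv_smul_iff₀ hc]
    ext i j
    simp only [hD, sub_mul, mul_sub, smul_mul_assoc, mul_smul_comm, one_mul, mul_one]
    simp [mul_apply]
  rw [h]
  exact (posSemidef_conjTranspose_mul_self D).smul (by simp)

/-- In blocks a_ij indexed by the last site, the difference is dim · ∑_k a_kk ⊗ (1 - e_kk) plus the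
Schur product of `a` with dim · 1 - J. Both are positive, the second by Schur's theorem. -/
theorem le_card_smul_appendOne_ptrace {n : ℕ}
    {a : Matrix (Fin (n + 1) → d) (Fin (n + 1) → d) ℂ} (ha : a.PosSemidef) :
    a ≤ (Fintype.card d : ℂ) • appendOne n (ptrace a) := by
  have h1 := ha.hadamard ((posSemidef_card_sub_ones (d := d)).submatrix
    fun x : Fin (n + 1) → d => x (Fin.last n))
  have h2 : ∀ k : d, (kronecker (a.submatrix (fun x : Fin n → d => Fin.snoc x k)
      (fun x : Fin n → d => Fin.snoc x k)) (diagonal fun i : d => if i = k then (0 : ℂ) else 1)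
      |>.submatrix (fun x : Fin (n + 1) → d => (Fin.init x, x (Fin.last n)))
        (fun x : Fin (n + 1) → d => (Fin.init x, x (Fin.last n)))).PosSemidef := by
    intro k
    refine ((ha.submatrix _).kronecker (PosSemidef.diagonal fun i => ?_)).submatrix _
    dsimp
    split_ifs <;> simp
  have h3 := (posSemidef_sum Finset.univ fun k _ => h2 k).smul
    (by simp : (0 : ℂ) ≤ (Fintype.card d : ℂ))
  rw [Matrix.le_iff]
  refine (congrArg Matrix.PosSemidef ?_).mpr (h3.add h1)
  ext x y
  obtain ⟨x, i, rfl⟩ : ∃ (x' : Fin n → d) (i : d), x = (Fin.snoc x' i : Fin (n + 1) → d) :=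
    ⟨Fin.init x, x (Fin.last n), (Fin.snoc_init_self x).symm⟩
  obtain ⟨y, j, rfl⟩ : ∃ (y' : Fin n → d) (j : d), y = (Fin.snoc y' j : Fin (n + 1) → d) :=
    ⟨Fin.init y, y (Fin.last n), (Fin.snoc_init_self y).symm⟩
  simp only [Matrix.sub_apply, Matrix.smul_apply, appendOne_apply, ptrace, of_apply, Fin.init_snoc,
    Fin.snoc_last, Matrix.add_apply, Matrix.sum_apply, submatrix_apply, kronecker, kroneckerMap_apply,
    hadamard_apply, smul_eq_mul]
  by_cases hij : i = j
  · subst hij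
    simp only [one_apply_eq, diagonal_apply_eq, mul_ite, mul_zero, mul_one]
    rw [← Finset.add_sum_erase Finset.univ _ (Finset.mem_univ i),
      ← Finset.add_sum_erase Finset.univ (fun k => if i = k then _ else _) (Finset.mem_univ i),
      if_pos rfl, Finset.sum_congr rfl fun k hk => if_neg (Finset.ne_of_mem_erase hk).symm,
      Fin.snoc_last, Fin.snoc_last, one_apply_eq]
    ring
  · simp [hij]

end TensorPowers

/-! ### Densities, Chernoff traces and the minimal error -/

section States

open Matrix
open scoped MatrixOrder

variable {d : Type*} [Fintype d] [DecidableEq d] {𝒜 : StarSubalgebra ℂ (Matrix d d ℂ)}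

theorem State.loc_star_mul_self_nonneg (ω : State 𝒜) (n : ℕ) (b : tensorAlg 𝒜 n) :
    0 ≤ ω.loc n (star b * b) := by
  convert ω.nonneg ⟨place (sites n) (b : Matrix (Fin n → d) (Fin n → d) ℂ),
    place_mem 𝒜 (sites n) b⟩ using 1
  refine congrArg ω.toLin (Subtype.ext ?_)
  change place (sites n) (star b.1 * b.1) = star (place (sites n) b.1) * place (sites n) b.1
  rw [map_mul, map_star]

theorem State.loc_nonneg (ω : State 𝒜) {n : ℕ} {a : tensorAlg 𝒜 n} (ha : a.1.PosSemidef) :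
    0 ≤ ω.loc n a := by
  obtain ⟨b, hb, hab⟩ := exists_star_mul_self _ a.2 ha
  have : a = star (⟨b, hb⟩ : tensorAlg 𝒜 n) * ⟨b, hb⟩ := Subtype.ext hab
  rw [this]
  exact ω.loc_star_mul_self_nonneg n _

theorem State.density_mem (ω : State 𝒜) (n : ℕ) : ω.density n ∈ tensorAlg 𝒜 n :=
  ((existsUnique_density (tensorAlg 𝒜 n) (ω.loc n)).choose : tensorAlg 𝒜 n).2

theorem State.loc_im_eq_zero (ω : State 𝒜) {n : ℕ} {a : tensorAlg 𝒜 n} (ha : star a = a) :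
    (ω.loc n a).im = 0 := by
  have h : (4 : ℂ) • a = star (a + 1) * (a + 1) - star (a - 1) * (a - 1) := by
    rw [star_add, star_sub, star_one, ha]
    simp only [mul_add, add_mul, mul_sub, sub_mul, mul_one, one_mul]
    module
  have h1 := (Complex.nonneg_iff.1 (ω.loc_star_mul_self_nonneg n (a + 1))).2
  have h2 := (Complex.nonneg_iff.1 (ω.loc_star_mul_self_nonneg n (a - 1))).2
  have h3 := congrArg (fun z => (ω.loc n z).im) h
  simp only [map_smul, map_sub, Complex.sub_im, smul_eq_mul, ← h1, ← h2] at h3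
  simpa using h3

theorem State.density_isHermitian (ω : State 𝒜) (n : ℕ) : (ω.density n).IsHermitian := by
  set ρ := ω.density n with hρ
  have hD : ρ - star ρ ∈ tensorAlg 𝒜 n :=
    sub_mem (ω.density_mem n) (star_mem (ω.density_mem n))
  set D := ρ - star ρ with hDdef
  have hDs : star D = -D := by rw [hDdef, star_sub, star_star, neg_sub]
  -- The anti-Hermitian part `D` of the density gives a Hermitian element iD. A state is real on it,
  -- which forces Tr D D* = 0.
  let a : tensorAlg 𝒜 n := Complex.I • ⟨D, hD⟩
  have hav : a.1 = Complex.I • D := rfl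
  have has : star a.1 = a.1 := by
    rw [hav, star_smul, hDs]
    simp
  have him := ω.loc_im_eq_zero (a := a) (Subtype.ext has)
  rw [ω.loc_eq_trace, ← hρ] at him
  have h1 : star ((ρ * a.1).trace) = (star ρ * a.1).trace := by
    have : star ((ρ * a.1).trace) = ((ρ * a.1)ᴴ).trace := (trace_conjTranspose _).symm
    rw [this, conjTranspose_mul, trace_mul_comm]
    change (star ρ * star a.1).trace = _
    rw [has]
  have h2 : star ((ρ * a.1).trace) = (ρ * a.1).trace := Complex.conj_eq_iff_im.2 him
  have h3 : (D * a.1).trace = 0 := by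
    rw [hDdef, sub_mul, trace_sub, ← h1, h2, sub_self]
  have h4 : (D * Dᴴ).trace = 0 := by
    have : Dᴴ = -D := hDs
    rw [this, mul_neg, trace_neg, neg_eq_zero]
    rw [hav, mul_smul_comm, trace_smul, smul_eq_mul] at h3
    exact (mul_eq_zero.1 h3).resolve_left Complex.I_ne_zero
  rw [trace_mul_conjTranspose_self_eq_zero_iff] at h4
  exact (sub_eq_zero.1 h4).symm

theorem State.density_posSemidef (ω : State 𝒜) (n : ℕ) : (ω.density n).PosSemidef := by
  refine posSemidef_of_trace_nonneg (tensorAlg 𝒜 n) (ω.density_isHermitian n) (ω.density_mem n)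
    fun a haB ha => ?_
  have := ω.loc_nonneg (a := ⟨a, haB⟩) ha
  rw [ω.loc_eq_trace] at this
  exact (Complex.nonneg_iff.1 this).1

theorem re_trace_smul_mul {N : Type*} [Fintype N] (c : ℝ) (A B : Matrix N N ℂ) :
    (((c : ℂ) • A * B).trace).re = c * ((A * B).trace).re := by
  rw [smul_mul_assoc, trace_smul, smul_eq_mul, Complex.re_ofReal_mul]

theorem smul_isHermitian {N : Type*} {A : Matrix N N ℂ} (hA : A.IsHermitian) (c : ℝ) :
    ((c : ℂ) • A).IsHermitian := by
  rw [IsHermitian, conjTranspose_smul, hA.eq]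
  simp

theorem State.density_le_of_upperFactorization {ω : State 𝒜} (h : ω.UpperFactorization) :
    ∃ b₀ ≥ (1 : ℝ), ∃ m₀ : ℕ, ∀ b ≥ b₀, ∀ m ≥ m₀, ∀ k ≥ 1,
      ω.density (k * m) ≤ ((b ^ (k - 1) : ℝ) : ℂ) • tensorPow k (ω.density m) := by
  obtain ⟨β, m₀, h⟩ := h
  -- `β` may be negative or below 1. Admitting every larger `b` lets both states share one constant
  -- later.
  refine ⟨max |β| 1, le_max_right _ _, m₀, fun b hb m hm k hk => ?_⟩
  have hρ := ω.density_posSemidef m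
  have hT := tensorPow_posSemidef k hρ
  rw [Matrix.le_iff]
  refine posSemidef_of_trace_nonneg (tensorAlg 𝒜 (k * m))
    ((smul_isHermitian hT.1 _).sub (ω.density_isHermitian _))
    (sub_mem (SMulMemClass.smul_mem _ (tensorPow_mem k (ω.density_mem m))) (ω.density_mem _))
    fun a haB ha => ?_
  have h1 := h m hm k hk ⟨a, haB⟩ ha
  rw [ω.loc_eq_trace] at h1
  have h2 := trace_mul_re_nonneg hT ha
  have h3 : β ^ (k - 1) ≤ b ^ (k - 1) := by
    refine (le_abs_self _).trans ?_
    rw [abs_pow]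
    exact pow_le_pow_left₀ (abs_nonneg _) ((le_max_left _ _).trans hb) _
  rw [sub_mul, trace_sub, Complex.sub_re, re_trace_smul_mul]
  have h4 := mul_le_mul_of_nonneg_right h3 h2
  simp only at h1
  linarith

theorem State.tensorPow_le_of_lowerFactorization {ω : State 𝒜} (h : ω.LowerFactorization) :
    ∃ b₀ ≥ (1 : ℝ), ∃ m₀ : ℕ, ∀ b ≥ b₀, ∀ m ≥ m₀, ∀ k ≥ 1,
      tensorPow k (ω.density m) ≤ ((b ^ (k - 1) : ℝ) : ℂ) • ω.density (k * m) := by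
  obtain ⟨α, m₀, hα, h⟩ := h
  refine ⟨max α⁻¹ 1, le_max_right _ _, m₀, fun b hb m hm k hk => ?_⟩
  have hρ := ω.density_posSemidef m
  have hT := tensorPow_posSemidef k hρ
  rw [Matrix.le_iff]
  refine posSemidef_of_trace_nonneg (tensorAlg 𝒜 (k * m))
    ((smul_isHermitian (ω.density_isHermitian _) _).sub hT.1)
    (sub_mem (SMulMemClass.smul_mem _ (ω.density_mem _)) (tensorPow_mem k (ω.density_mem m)))
    fun a haB ha => ?_
  have h1 := h m hm k hk ⟨a, haB⟩ ha
  rw [ω.loc_eq_trace] at h1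
  have h2 := trace_mul_re_nonneg hT ha
  have h3 : 1 ≤ b ^ (k - 1) * α ^ (k - 1) := by
    rw [← mul_pow]
    refine one_le_pow₀ ?_
    calc (1 : ℝ) = α⁻¹ * α := (inv_mul_cancel₀ hα.ne').symm
      _ ≤ b * α := mul_le_mul_of_nonneg_right ((le_max_left _ _).trans hb) hα.le
  have hb0 : 0 ≤ b ^ (k - 1) :=
    pow_nonneg (zero_le_one.trans ((le_max_right _ _).trans hb)) _
  rw [sub_mul, trace_sub, Complex.sub_re, re_trace_smul_mul]
  have h4 := mul_le_mul_of_nonneg_right h3 h2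
  have h5 := mul_le_mul_of_nonneg_left h1 hb0
  simp only at h5
  rw [← mul_assoc] at h5
  linarith

theorem State.loc_appendOne (ω : State 𝒜) {n : ℕ} (a : tensorAlg 𝒜 n) :
    ω.loc (n + 1) ⟨appendOne n a.1, appendOne_mem a.2⟩ = ω.loc n a :=
  congrArg ω.toLin (Subtype.ext (place_appendOne a.1))

theorem appendOne_posSemidef {n : ℕ} {a : Matrix (Fin n → d) (Fin n → d) ℂ} (ha : a.PosSemidef) :
    (appendOne n a).PosSemidef := by
  obtain ⟨b, -, rfl⟩ := exists_star_mul_self ⊤ (StarSubalgebra.mem_top) ha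
  rw [map_mul, map_star]
  exact posSemidef_conjTranspose_mul_self _

/-- For positive a, ω_{n+1}(a) ≤ dim · ω_{n+1}(ptrace a ⊗ 1) = dim · ω_n(ptrace a). The constant is
dim + 1 so that it is visibly positive. -/
theorem State.density_succ_le (ω : State 𝒜) (n : ℕ) :
    ω.density (n + 1) ≤ (((Fintype.card d + 1 : ℝ)) : ℂ) • appendOne n (ω.density n) := by
  have hA := appendOne_posSemidef (ω.density_posSemidef n)
  rw [Matrix.le_iff]
  refine posSemidef_of_trace_nonneg (tensorAlg 𝒜 (n + 1))
    ((smul_isHermitian hA.1 _).sub (ω.density_isHermitian _))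
    (sub_mem (SMulMemClass.smul_mem _ (appendOne_mem (ω.density_mem n))) (ω.density_mem _))
    fun a haB ha => ?_
  have h1 := trace_mul_re_nonneg (ω.density_posSemidef (n + 1))
    (Matrix.le_iff.1 (le_card_smul_appendOne_ptrace ha))
  have h2 : (appendOne n (ω.density n) * a).trace =
      (ω.density (n + 1) * appendOne n (ptrace a)).trace := by
    have e := ω.loc_appendOne ⟨ptrace a, ptrace_mem haB⟩
    rw [ω.loc_eq_trace, ω.loc_eq_trace] at e
    rw [trace_appendOne_mul]
    exact e.symm
  have h3 := trace_mul_re_nonneg hA ha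
  rw [mul_sub, trace_sub, Complex.sub_re, mul_smul_comm, trace_smul, ← h2, smul_eq_mul,
    ← Complex.ofReal_natCast, Complex.re_ofReal_mul] at h1
  rw [sub_mul, trace_sub, Complex.sub_re, re_trace_smul_mul]
  linarith

/-! ### Inequalities for the Chernoff traces -/

theorem trace_mul_im_eq_zero {N : Type*} [Fintype N] {A B : Matrix N N ℂ} (hA : A.IsHermitian)
    (hB : B.IsHermitian) : ((A * B).trace).im = 0 := by
  rw [← Complex.conj_eq_iff_im]
  change star _ = _
  rw [← trace_conjTranspose, conjTranspose_mul, hA.eq, hB.eq, trace_mul_comm]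

/-- Operator monotonicity applies to both factors, and the constants combine to c^(1-t) c^t = c. -/
theorem trace_suppPow_le {N : Type*} [Fintype N] [DecidableEq N] {R R' S S' : Matrix N N ℂ}
    (hR : R.PosSemidef) (hR' : R'.PosSemidef) (hS : S.PosSemidef) (hS' : S'.PosSemidef) {c : ℝ}
    (hc : 0 < c) (hRR : R ≤ (c : ℂ) • R') (hSS : S ≤ (c : ℂ) • S') {t : ℝ}
    (ht : t ∈ Icc (0 : ℝ) 1) :
    ((suppPow R (1 - t) * suppPow S t).trace).re ≤
      c * ((suppPow R' (1 - t) * suppPow S' t).trace).re := by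
  have ht' : 1 - t ∈ Icc (0 : ℝ) 1 := ⟨by linarith [ht.2], by linarith [ht.1]⟩
  have hS'' : ((c : ℂ) • S').PosSemidef := hS'.smul (by exact_mod_cast hc.le)
  refine (trace_mul_re_mono (suppPow_posSemidef hR _) (suppPow_posSemidef hS'' t)
    (suppPow_mono hR hRR ht') (suppPow_mono hS hSS ht)).trans (le_of_eq ?_)
  rw [suppPow_smul hR' hc, suppPow_smul hS' hc, re_trace_smul_mul, mul_smul_comm, trace_smul,
    smul_eq_mul, Complex.re_ofReal_mul, ← mul_assoc, ← Real.rpow_add hc]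
  simp

theorem re_trace_suppPow_tensorPow (k : ℕ) {m : ℕ} {R S : Matrix (Fin m → d) (Fin m → d) ℂ}
    (hR : R.PosSemidef) (hS : S.PosSemidef) (t : ℝ) :
    ((suppPow (tensorPow k R) (1 - t) * suppPow (tensorPow k S) t).trace).re =
      ((suppPow R (1 - t) * suppPow S t).trace).re ^ k := by
  rw [suppPow_tensorPow k hR, suppPow_tensorPow k hS, ← tensorPow_mul, trace_tensorPow]
  -- The trace is real, so the real part of its power is the power of its real part.
  have him := trace_mul_im_eq_zero (suppPow_posSemidef hR (1 - t)).1 (suppPow_posSemidef hS t).1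
  have : (suppPow R (1 - t) * suppPow S t).trace =
      (((suppPow R (1 - t) * suppPow S t).trace.re : ℝ) : ℂ) := Complex.ext rfl (by simp [him])
  rw [this, ← Complex.ofReal_pow, Complex.ofReal_re, Complex.ofReal_re]

theorem chernoffTrace_nonneg (ω σ : State 𝒜) (n : ℕ) (t : ℝ) : 0 ≤ chernoffTrace ω σ n t :=
  trace_mul_re_nonneg (suppPow_posSemidef (ω.density_posSemidef n) _)
    (suppPow_posSemidef (σ.density_posSemidef n) _)

theorem chernoffTrace_succ_le (ω σ : State 𝒜) (n : ℕ) {t : ℝ} (ht : t ∈ Icc (0 : ℝ) 1) :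
    chernoffTrace ω σ (n + 1) t ≤ (Fintype.card d + 1) ^ 2 * chernoffTrace ω σ n t := by
  have hω := ω.density_posSemidef n
  have hσ := σ.density_posSemidef n
  have hD : (0 : ℝ) < Fintype.card d + 1 := by positivity
  have h := trace_suppPow_le (ω.density_posSemidef (n + 1)) (appendOne_posSemidef hω)
    (σ.density_posSemidef (n + 1)) (appendOne_posSemidef hσ) hD (ω.density_succ_le n)
    (σ.density_succ_le n) ht
  rw [suppPow_map _ hω.1, suppPow_map _ hσ.1, ← map_mul, trace_appendOne,
    ← Complex.ofReal_natCast, Complex.re_ofReal_mul] at h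
  refine h.trans ?_
  have h0 := chernoffTrace_nonneg ω σ n t
  change (Fintype.card d + 1 : ℝ) * (Fintype.card d * chernoffTrace ω σ n t) ≤ _
  have := mul_nonneg hD.le h0
  nlinarith

theorem chernoffTrace_mul_le {ω σ : State 𝒜} {k m : ℕ} {c : ℝ} (hc : 0 < c)
    (hω : ω.density (k * m) ≤ (c : ℂ) • tensorPow k (ω.density m))
    (hσ : σ.density (k * m) ≤ (c : ℂ) • tensorPow k (σ.density m)) {t : ℝ}
    (ht : t ∈ Icc (0 : ℝ) 1) :
    chernoffTrace ω σ (k * m) t ≤ c * chernoffTrace ω σ m t ^ k := by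
  have hω0 := ω.density_posSemidef m
  have hσ0 := σ.density_posSemidef m
  have := trace_suppPow_le (ω.density_posSemidef _) (tensorPow_posSemidef k hω0)
    (σ.density_posSemidef _) (tensorPow_posSemidef k hσ0) hc hω hσ ht
  rwa [re_trace_suppPow_tensorPow k hω0 hσ0] at this

theorem chernoffTrace_pow_le {ω σ : State 𝒜} {k m : ℕ} {c : ℝ} (hc : 0 < c)
    (hω : tensorPow k (ω.density m) ≤ (c : ℂ) • ω.density (k * m))
    (hσ : tensorPow k (σ.density m) ≤ (c : ℂ) • σ.density (k * m)) {t : ℝ}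
    (ht : t ∈ Icc (0 : ℝ) 1) :
    chernoffTrace ω σ m t ^ k ≤ c * chernoffTrace ω σ (k * m) t := by
  have hω0 := ω.density_posSemidef m
  have hσ0 := σ.density_posSemidef m
  have := trace_suppPow_le (tensorPow_posSemidef k hω0) (ω.density_posSemidef _)
    (tensorPow_posSemidef k hσ0) (σ.density_posSemidef _) hc hω hσ ht
  rwa [re_trace_suppPow_tensorPow k hω0 hσ0] at this

theorem continuous_chernoffTrace (ω σ : State 𝒜) (n : ℕ) :
    Continuous fun t => chernoffTrace ω σ n t := by
  have h1 := (continuous_suppPow (ω.density_posSemidef n)).comp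
    (continuous_const.sub continuous_id : Continuous fun t : ℝ => 1 - t)
  have h2 := continuous_suppPow (σ.density_posSemidef n)
  exact Complex.continuous_re.comp (h1.mul h2).matrix_trace

theorem re_trace_unitaryDiag_mul_unitaryDiag {N : Type*} [Fintype N] [DecidableEq N]
    (U : Matrix N N ℂ) {V : Matrix N N ℂ} (hV : V ∈ unitary (Matrix N N ℂ)) (a : N → ℝ)
    {b : N → ℝ} (hb : ∀ i, 0 ≤ b i) :
    ((unitaryDiag U a * unitaryDiag V b).trace).re =
      ∑ i, ∑ j, a i * b j * ‖(star U * V) i j‖ ^ 2 := by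
  have h1 : unitaryDiag V b = unitaryDiag V (fun i => √(b i)) *
      (unitaryDiag V (fun i => √(b i)))ᴴ := by
    rw [(isHermitian_unitaryDiag V _).eq, unitaryDiag_mul hV]
    simp [Real.mul_self_sqrt (hb _)]
  rw [h1, trace_unitaryDiag_mul_mul_conjTranspose U hV]
  refine Finset.sum_congr rfl fun i _ => Finset.sum_congr rfl fun j _ => ?_
  have h2 : star U * unitaryDiag V (fun i => √(b i)) * V =
      star U * V * diagonal (fun i => ((√(b i) : ℝ) : ℂ)) := by
    rw [unitaryDiag, mul_assoc, mul_assoc, Unitary.star_mul_self_of_mem hV, mul_one, mul_assoc]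
  rw [h2, mul_diagonal, norm_mul, mul_pow, Complex.norm_real, Real.norm_eq_abs, sq_abs,
    Real.sq_sqrt (hb j)]
  ring

/-- The Chernoff trace as a sum over a classical alphabet. -/
theorem re_trace_suppPow_unitaryDiag {N : Type*} [Fintype N] [DecidableEq N]
    {U V : Matrix N N ℂ} (hU : U ∈ unitary (Matrix N N ℂ)) (hV : V ∈ unitary (Matrix N N ℂ))
    {a b : N → ℝ} (ha : ∀ i, 0 ≤ a i) (hb : ∀ i, 0 ≤ b i) (t : ℝ) :
    ((suppPow (unitaryDiag U a) (1 - t) * suppPow (unitaryDiag V b) t).trace).re =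
      ∑ z : N × N,
        if a z.1 * ‖(star U * V) z.1 z.2‖ ^ 2 = 0 ∨ b z.2 * ‖(star U * V) z.1 z.2‖ ^ 2 = 0 then 0
        else (a z.1 * ‖(star U * V) z.1 z.2‖ ^ 2) ^ (1 - t) *
          (b z.2 * ‖(star U * V) z.1 z.2‖ ^ 2) ^ t := by
  rw [suppPow_unitaryDiag hU, suppPow_unitaryDiag hV, re_trace_unitaryDiag_mul_unitaryDiag U hV,
    Fintype.sum_prod_type]
  · refine Finset.sum_congr rfl fun i _ => Finset.sum_congr rfl fun j _ => ?_
    set w := ‖(star U * V) i j‖ ^ 2 with hw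
    have hw0 : 0 ≤ w := sq_nonneg _
    by_cases hai : a i = 0
    · simp [hai]
    by_cases hbj : b j = 0
    · simp [hbj]
    by_cases hwz : w = 0
    · simp [hwz]
    have hwp : 0 < w := lt_of_le_of_ne hw0 (Ne.symm hwz)
    simp only [hai, hbj, hwz, mul_eq_zero, or_self, if_false]
    rw [Real.mul_rpow (ha i) hw0, Real.mul_rpow (hb j) hw0]
    -- The overlap splits into its powers 1 - t and t, one for each classical weight.
    have : w = w ^ (1 - t) * w ^ t := by rw [← Real.rpow_add hwp]; simp
    nth_rewrite 1 [this]
    ring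
  · intro i
    split_ifs
    · exact le_rfl
    · exact Real.rpow_nonneg (hb i) t

/-! ### The minimal error probability -/

theorem errorProb_eq (κ : ℝ) (ω σ : State 𝒜) (n : ℕ) (a : tensorAlg 𝒜 n) :
    errorProb κ ω σ n a = κ * ((ω.density n * (1 - a.1)).trace).re +
      (1 - κ) * ((σ.density n * a.1).trace).re := by
  rw [errorProb, ω.loc_eq_trace, σ.loc_eq_trace]
  rfl

theorem errorProb_nonneg {κ : ℝ} (hκ : κ ∈ Ioo (0 : ℝ) 1) (ω σ : State 𝒜) {n : ℕ}
    {a : tensorAlg 𝒜 n} (ha : a.1.PosSemidef) (ha1 : (1 - a.1).PosSemidef) :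
    0 ≤ errorProb κ ω σ n a := by
  rw [errorProb_eq]
  exact add_nonneg
    (mul_nonneg hκ.1.le (trace_mul_re_nonneg (ω.density_posSemidef n) ha1))
    (mul_nonneg (sub_nonneg.2 hκ.2.le) (trace_mul_re_nonneg (σ.density_posSemidef n) ha))

theorem minError_le {κ : ℝ} (hκ : κ ∈ Ioo (0 : ℝ) 1) (ω σ : State 𝒜) {n : ℕ}
    {a : tensorAlg 𝒜 n} (ha : a.1.PosSemidef) (ha1 : (1 - a.1).PosSemidef) :
    minError κ ω σ n ≤ errorProb κ ω σ n a := by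
  refine csInf_le ⟨0, ?_⟩ ⟨a, ha, ha1, rfl⟩
  rintro _ ⟨a, ha, ha1, rfl⟩
  exact errorProb_nonneg hκ ω σ ha ha1

theorem le_minError {κ : ℝ} (ω σ : State 𝒜) {n : ℕ} {x : ℝ}
    (h : ∀ a : tensorAlg 𝒜 n, a.1.PosSemidef → (1 - a.1).PosSemidef → x ≤ errorProb κ ω σ n a) :
    x ≤ minError κ ω σ n := by
  refine le_csInf ⟨_, 0, PosSemidef.zero, ?_, rfl⟩ ?_
  · simpa using PosSemidef.one
  · rintro _ ⟨a, ha, ha1, rfl⟩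
    exact h a ha ha1

/-- A test on n sites, tensored with 1, has the same error on n + 1 sites. -/
theorem minError_antitone {κ : ℝ} (hκ : κ ∈ Ioo (0 : ℝ) 1) (ω σ : State 𝒜) :
    Antitone (minError κ ω σ) := by
  refine antitone_nat_of_succ_le fun n => le_minError ω σ fun a ha ha1 => ?_
  have h1 : (1 - appendOne n a.1).PosSemidef := by
    rw [← map_one (appendOne n), ← map_sub]
    exact appendOne_posSemidef ha1
  refine (minError_le hκ ω σ (a := ⟨appendOne n a.1, appendOne_mem a.2⟩)
    (appendOne_posSemidef ha) h1).trans (le_of_eq ?_)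
  have e : (1 : tensorAlg 𝒜 (n + 1)) - ⟨appendOne n a.1, appendOne_mem a.2⟩ =
      ⟨appendOne n (1 - a).1, appendOne_mem (1 - a).2⟩ := by
    refine Subtype.ext ?_
    change 1 - appendOne n a.1 = appendOne n (1 - a.1)
    rw [map_sub, map_one]
  rw [errorProb, errorProb, e, ω.loc_appendOne, σ.loc_appendOne]

theorem minError_le_chernoffTrace {κ : ℝ} (hκ : κ ∈ Ioo (0 : ℝ) 1) (ω σ : State 𝒜) (n : ℕ)
    {t : ℝ} (ht : t ∈ Icc (0 : ℝ) 1) : minError κ ω σ n ≤ chernoffTrace ω σ n t := by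
  have hκ' : 0 < 1 - κ := sub_pos.2 hκ.2
  have hω := ω.density_posSemidef n
  have hσ := σ.density_posSemidef n
  obtain ⟨a, haB, ha, ha1, h⟩ := exists_test_le_trace_suppPow (tensorAlg 𝒜 n)
    (R := (κ : ℂ) • ω.density n) (S := ((1 - κ : ℝ) : ℂ) • σ.density n)
    (hω.smul (by exact_mod_cast hκ.1.le)) (hσ.smul (by exact_mod_cast hκ'.le))
    (SMulMemClass.smul_mem _ (ω.density_mem n)) (SMulMemClass.smul_mem _ (σ.density_mem n)) ht
  refine (minError_le hκ ω σ (a := ⟨a, haB⟩) ha ha1).trans ?_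
  rw [errorProb_eq]
  rw [re_trace_smul_mul, re_trace_smul_mul] at h
  refine h.trans ?_
  rw [suppPow_smul hω hκ.1, suppPow_smul hσ hκ', re_trace_smul_mul, mul_smul_comm, trace_smul,
    smul_eq_mul, Complex.re_ofReal_mul, ← mul_assoc]
  refine mul_le_of_le_one_left (chernoffTrace_nonneg ω σ n t) ?_
  exact mul_le_one₀ (Real.rpow_le_one hκ.1.le hκ.2.le (by linarith [ht.2]))
    (Real.rpow_nonneg hκ'.le _) (Real.rpow_le_one hκ'.le (by linarith [hκ.1]) ht.1)

/-- `t` and `C` come from the classical pair a_i |⟨u_i, v_j⟩|², b_j |⟨u_i, v_j⟩|² attached to m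
sites, so they depend neither on `k` nor on κ. -/
theorem exists_pow_chernoffTrace_le_minError (ω σ : State 𝒜) (m : ℕ) :
    ∃ t ∈ Icc (0 : ℝ) 1, ∃ C : ℝ, ∀ κ ∈ Ioo (0 : ℝ) 1, ∀ (k : ℕ) (c : ℝ), 0 < c →
      tensorPow k (ω.density m) ≤ (c : ℂ) • ω.density (k * m) →
      tensorPow k (σ.density m) ≤ (c : ℂ) • σ.density (k * m) →
      min κ (1 - κ) / 2 * (chernoffTrace ω σ m t ^ k * Real.exp (-(C * √k))) ≤
        c * minError κ ω σ (k * m) := by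
  obtain ⟨U, hU, a, ha, hωU⟩ := exists_unitaryDiag (ω.density_posSemidef m)
  obtain ⟨V, hV, b, hb, hσV⟩ := exists_unitaryDiag (σ.density_posSemidef m)
  set w : (Fin m → d) × (Fin m → d) → ℝ := fun z => ‖(star U * V) z.1 z.2‖ ^ 2 with hw
  obtain ⟨t, ht, C, h⟩ := exists_exponent (p := fun z => a z.1 * w z) (q := fun z => b z.2 * w z)
    (fun z => mul_nonneg (ha _) (sq_nonneg _)) (fun z => mul_nonneg (hb _) (sq_nonneg _))
  refine ⟨t, ht, C, fun κ hκ k c hc hω hσ => ?_⟩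
  have hct : chernoffTrace ω σ m t = ∑ z, if a z.1 * w z = 0 ∨ b z.2 * w z = 0 then 0
      else (a z.1 * w z) ^ (1 - t) * (b z.2 * w z) ^ t := by
    rw [chernoffTrace, hωU, hσV]
    exact re_trace_suppPow_unitaryDiag hU hV ha hb t
  have hk := h k
  rw [← hct] at hk
  rw [← div_le_iff₀' hc]
  refine le_minError ω σ fun T hT hT1 => ?_
  rw [div_le_iff₀' hc, errorProb_eq]
  have hNS := half_sum_min_le_error (tensorPow_mem_unitary k hU) (tensorPow_mem_unitary k hV)
    (a := fun x => ∏ i, a (blocks d k m x i)) (b := fun x => ∏ i, b (blocks d k m x i))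
    (fun x => Finset.prod_nonneg fun i _ => ha _) (fun x => Finset.prod_nonneg fun i _ => hb _)
    hT hT1
  rw [← tensorPow_unitaryDiag, ← tensorPow_unitaryDiag, ← hωU, ← hσV] at hNS
  -- The overlaps of product eigenvectors factorize over the blocks, so the classical pair of the
  -- tensor powers is the k-fold product pair.
  have hsum : ∑ x : Fin (k * m) → d, ∑ y : Fin (k * m) → d,
      min (∏ i, a (blocks d k m x i)) (∏ i, b (blocks d k m y i)) *
        ‖(star (tensorPow k U) * tensorPow k V) x y‖ ^ 2 =
      ∑ z : Fin k → (Fin m → d) × (Fin m → d),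
        min (∏ i, a (z i).1 * w (z i)) (∏ i, b (z i).2 * w (z i)) := by
    rw [← (Equiv.arrowProdEquivProdArrow (Fin k) (fun _ => Fin m → d)
      (fun _ => Fin m → d)).symm.sum_comp, Fintype.sum_prod_type,
      ← (blocks d k m).sum_comp]
    refine Finset.sum_congr rfl fun x _ => ?_
    rw [← (blocks d k m).sum_comp]
    refine Finset.sum_congr rfl fun y _ => ?_
    rw [star_tensorPow, ← tensorPow_mul, tensorPow_apply, norm_prod, ← Finset.prod_pow]
    simp only [Finset.prod_mul_distrib]
    rw [← min_mul_of_nonneg _ _ (Finset.prod_nonneg fun i _ => sq_nonneg _)]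
    rfl
  rw [hsum] at hNS
  have h1 := trace_mul_re_nonneg (Matrix.le_iff.1 hω) hT1
  have h2 := trace_mul_re_nonneg (Matrix.le_iff.1 hσ) hT
  rw [sub_mul, trace_sub, Complex.sub_re, re_trace_smul_mul] at h1 h2
  have e1 := trace_mul_re_nonneg (ω.density_posSemidef (k * m)) hT1
  have e2 := trace_mul_re_nonneg (σ.density_posSemidef (k * m)) hT
  have hμ : 0 ≤ min κ (1 - κ) := le_min hκ.1.le (sub_nonneg.2 hκ.2.le)
  have f1 := mul_le_mul_of_nonneg_right (min_le_left κ (1 - κ)) (mul_nonneg hc.le e1)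
  have f2 := mul_le_mul_of_nonneg_right (min_le_right κ (1 - κ)) (mul_nonneg hc.le e2)
  have f3 := mul_le_mul_of_nonneg_left
    (((div_le_div_iff_of_pos_right two_pos).2 hk).trans (hNS.trans (add_le_add (sub_nonneg.1 h1)
      (sub_nonneg.1 h2)))) hμ
  calc _ = min κ (1 - κ) * (chernoffTrace ω σ m t ^ k * Real.exp (-(C * √k)) / 2) := by ring
    _ ≤ _ := f3
    _ ≤ _ := by linarith

/-- Either the supports are orthogonal, or no Chernoff trace vanishes. -/
theorem chernoffTrace_eq_zero_of_eq_zero (ω σ : State 𝒜) (n : ℕ) {s : ℝ}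
    (h : chernoffTrace ω σ n s = 0) (t : ℝ) : chernoffTrace ω σ n t = 0 := by
  obtain ⟨U, hU, a, ha, hωU⟩ := exists_unitaryDiag (ω.density_posSemidef n)
  obtain ⟨V, hV, b, hb, hσV⟩ := exists_unitaryDiag (σ.density_posSemidef n)
  rw [chernoffTrace, hωU, hσV, re_trace_suppPow_unitaryDiag hU hV ha hb] at h ⊢
  rw [Finset.sum_eq_zero_iff_of_nonneg] at h
  · refine Finset.sum_eq_zero fun z hz => ?_
    have hz' := h z hz
    have ha' : 0 ≤ a z.1 * ‖(star U * V) z.1 z.2‖ ^ 2 := mul_nonneg (ha _) (sq_nonneg _)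
    have hb' : 0 ≤ b z.2 * ‖(star U * V) z.1 z.2‖ ^ 2 := mul_nonneg (hb _) (sq_nonneg _)
    by_contra hne
    rw [ite_eq_left_iff, Classical.not_imp] at hne
    rw [if_neg hne.1] at hz'
    push Not at hne
    have h1 := Real.rpow_pos_of_pos (lt_of_le_of_ne ha' (Ne.symm hne.1.1)) (1 - s)
    have h2 := Real.rpow_pos_of_pos (lt_of_le_of_ne hb' (Ne.symm hne.1.2)) s
    exact (mul_pos h1 h2).ne' hz'
  · intro z _
    split_ifs
    · exact le_rfl
    · exact mul_nonneg (Real.rpow_nonneg (mul_nonneg (ha _) (sq_nonneg _)) _)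
        (Real.rpow_nonneg (mul_nonneg (hb _) (sq_nonneg _)) _)

end States

/-! ### Exponential rates of almost submultiplicative sequences -/

section Rates

theorem rate_of_pos (n : ℕ) {x : ℝ} (hx : 0 < x) :
    rate n x = ((Real.log x / n : ℝ) : EReal) := by
  rw [rate, ENNReal.log_ofReal, if_neg (not_le.2 hx), ← EReal.coe_mul]
  congr 1
  ring

theorem rate_zero {n : ℕ} (hn : 0 < n) : rate n 0 = ⊥ := by
  rw [rate, ENNReal.ofReal_zero, ENNReal.log_zero]
  exact EReal.coe_mul_bot_of_pos (by positivity)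

theorem rate_lt_iff {n : ℕ} (hn : 0 < n) {x : ℝ} (hx : 0 ≤ x) (y : ℝ) :
    rate n x < (y : EReal) ↔ x < Real.exp (n * y) := by
  have hn' : (0 : ℝ) < n := by exact_mod_cast hn
  rcases hx.eq_or_lt with rfl | hx
  · rw [rate_zero hn]
    simp [Real.exp_pos, EReal.bot_lt_coe]
  · rw [rate_of_pos n hx, EReal.coe_lt_coe_iff, div_lt_iff₀ hn', ← Real.log_lt_iff_lt_exp hx,
      mul_comm]

theorem le_rate_iff {n : ℕ} (hn : 0 < n) {x : ℝ} (hx : 0 ≤ x) (y : ℝ) :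
    (y : EReal) ≤ rate n x ↔ Real.exp (n * y) ≤ x := by
  rw [← not_lt, rate_lt_iff hn hx, not_lt]

theorem rate_mono (n : ℕ) {x y : ℝ} (hxy : x ≤ y) : rate n x ≤ rate n y := by
  refine mul_le_mul_of_nonneg_left (ENNReal.log_monotone (ENNReal.ofReal_le_ofReal hxy)) ?_
  exact_mod_cast (by positivity : (0 : ℝ) ≤ 1 / n)

variable {c : ℕ → ℝ} {B D : ℝ} {m₀ : ℕ}

theorem le_pow_mul_of_succ_le (hD : 0 ≤ D) (hc : ∀ n, c (n + 1) ≤ D * c n) (n r : ℕ) :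
    c (n + r) ≤ D ^ r * c n := by
  induction r with
  | zero => simp
  | succ r ih =>
    calc c (n + (r + 1)) ≤ D * c (n + r) := hc (n + r)
      _ ≤ D * (D ^ r * c n) := mul_le_mul_of_nonneg_left ih hD
      _ = D ^ (r + 1) * c n := by ring

/-- Fekete's division n = k m + r: the remainder costs at most D^m, which disappears after dividing
by n, and the blocks cost B^k. The strict bound by an exponential also covers c m = 0. -/
theorem limsup_rate_le (hc0 : ∀ n, 0 ≤ c n) (hB : 1 ≤ B) (hD : 1 ≤ D)
    (hsucc : ∀ n, c (n + 1) ≤ D * c n) {m : ℕ} (hm : 0 < m)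
    (hmul : ∀ k ≥ 1, c (k * m) ≤ B ^ (k - 1) * c m ^ k) {y : ℝ}
    (hy : c m < Real.exp (m * y)) :
    limsup (fun n => rate n (c n)) atTop ≤ ((y + Real.log B / m : ℝ) : EReal) := by
  have hm' : (0 : ℝ) < m := by exact_mod_cast hm
  have hB0 : 0 < B := by linarith
  have hD0 : 0 < D := by linarith
  set v : ℝ := y + Real.log B / m with hv
  refine le_of_forall_gt_imp_ge_of_dense fun z hz => ?_
  obtain ⟨y', hy', hyz⟩ := EReal.lt_iff_exists_real_btwn.1 hz
  rw [EReal.coe_lt_coe_iff] at hy'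
  refine le_trans ?_ hyz.le
  have hev : ∀ᶠ n : ℕ in atTop, m * Real.log D + m * |v| < n * (y' - v) :=
    (tendsto_natCast_atTop_atTop.atTop_mul_const (sub_pos.2 hy')).eventually_gt_atTop _
  refine limsup_le_of_le (by isBoundedDefault) ?_
  filter_upwards [hev, eventually_ge_atTop m] with n hn hnm
  have hn0 : 0 < n := hm.trans_le hnm
  refine ((rate_lt_iff hn0 (hc0 n) y').2 ?_).le
  set k := n / m with hk
  set r := n % m with hr
  have hnk : k * m + r = n := by rw [mul_comm]; exact Nat.div_add_mod n m
  have hk1 : 1 ≤ k := (Nat.one_le_div_iff hm).2 hnm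
  have hrm : r ≤ m := (Nat.mod_lt n hm).le
  have h1 : c n ≤ D ^ m * (B ^ k * Real.exp (m * y) ^ k) := by
    calc c n = c (k * m + r) := by rw [hnk]
      _ ≤ D ^ r * c (k * m) := le_pow_mul_of_succ_le hD0.le hsucc _ _
      _ ≤ D ^ m * (B ^ k * Real.exp (m * y) ^ k) := by
        refine mul_le_mul (pow_le_pow_right₀ hD hrm) ?_ (hc0 _) (by positivity)
        refine (hmul k hk1).trans ?_
        exact mul_le_mul (pow_le_pow_right₀ hB (Nat.sub_le k 1))
          (pow_le_pow_left₀ (hc0 m) hy.le k) (pow_nonneg (hc0 m) k) (by positivity)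
  refine h1.trans_lt ?_
  have h2 : D ^ m * (B ^ k * Real.exp (m * y) ^ k) =
      Real.exp (m * Real.log D + (k * m) * v) := by
    have e : (k * m : ℝ) * v = k * Real.log B + k * (m * y) := by
      rw [hv]
      field_simp
      ring
    rw [e, Real.exp_add, Real.exp_add, Real.exp_nat_mul _ k, Real.exp_nat_mul _ k,
      Real.exp_nat_mul (Real.log D), Real.exp_log hD0, Real.exp_log hB0]
  rw [h2, Real.exp_lt_exp]
  have h3 : (n : ℝ) = k * m + r := by exact_mod_cast hnk.symm
  have h4 : -(m * |v|) ≤ r * v := by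
    have := mul_le_mul_of_nonneg_left (neg_abs_le v) (Nat.cast_nonneg (α := ℝ) r)
    have h5 : (r : ℝ) * |v| ≤ m * |v| :=
      mul_le_mul_of_nonneg_right (by exact_mod_cast hrm) (abs_nonneg v)
    linarith
  have h6 : (k * m : ℝ) * v = n * v - r * v := by rw [h3]; ring
  rw [h6]
  linarith

theorem tendsto_rate_limsup (hc0 : ∀ n, 0 ≤ c n) (hB : 1 ≤ B) (hD : 1 ≤ D)
    (hsucc : ∀ n, c (n + 1) ≤ D * c n)
    (hmul : ∀ m ≥ m₀, ∀ k ≥ 1, c (k * m) ≤ B ^ (k - 1) * c m ^ k) :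
    Tendsto (fun n => rate n (c n)) atTop (𝓝 (limsup (fun n => rate n (c n)) atTop)) := by
  refine tendsto_of_le_liminf_of_limsup_le ?_ le_rfl
  refine le_of_forall_gt_imp_ge_of_dense fun z hz => ?_
  obtain ⟨x, hx, hxz⟩ := EReal.lt_iff_exists_real_btwn.1 hz
  obtain ⟨y, hy, hyx⟩ := EReal.lt_iff_exists_real_btwn.1 hx
  rw [EReal.coe_lt_coe_iff] at hyx
  refine le_trans ?_ hxz.le
  have hev : ∀ᶠ m : ℕ in atTop, Real.log B < m * (x - y) :=
    (tendsto_natCast_atTop_atTop.atTop_mul_const (sub_pos.2 hyx)).eventually_gt_atTop _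
  -- Some large `m` has rate below `y`, close to the liminf, and (log B)/m ≤ x - y. The limsup is
  -- then at most `x`.
  obtain ⟨m, hlt, hm1, hm0, hmB⟩ := ((frequently_lt_of_liminf_lt (by isBoundedDefault) hy).and_eventually
    ((eventually_ge_atTop 1).and ((eventually_ge_atTop m₀).and hev))).exists
  have hm' : (0 : ℝ) < m := by exact_mod_cast hm1
  refine (limsup_rate_le hc0 hB hD hsucc hm1 (hmul m hm0)
    ((rate_lt_iff hm1 (hc0 m) y).1 hlt)).trans ?_
  rw [EReal.coe_le_coe_iff]
  have : Real.log B / m ≤ x - y := by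
    rw [div_le_iff₀ hm']
    linarith
  linarith

theorem limsup_rate_eq_bot (hc0 : ∀ n, 0 ≤ c n) (hB : 1 ≤ B) (hD : 1 ≤ D)
    (hsucc : ∀ n, c (n + 1) ≤ D * c n) {m : ℕ} (hm : 0 < m)
    (hmul : ∀ k ≥ 1, c (k * m) ≤ B ^ (k - 1) * c m ^ k) (hcm : c m = 0) :
    limsup (fun n => rate n (c n)) atTop = ⊥ := by
  refine EReal.eq_bot_iff_forall_lt _ |>.2 fun x => ?_
  refine (limsup_rate_le (y := x - 1 - Real.log B / m) hc0 hB hD hsucc hm hmul ?_).trans_lt ?_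
  · rw [hcm]
    exact Real.exp_pos _
  · rw [EReal.coe_lt_coe_iff]
    linarith

theorem rate_mul_le (hB : 1 ≤ B) {m k : ℕ} (hm : 0 < m) (hk : 1 ≤ k)
    (hmul : c (k * m) ≤ B ^ (k - 1) * c m ^ k) (hcm : 0 < c m) (hckm : 0 < c (k * m)) :
    rate (k * m) (c (k * m)) ≤ ((Real.log (c m) / m + Real.log B / m : ℝ) : EReal) := by
  have hm' : (0 : ℝ) < m := by exact_mod_cast hm
  have hk' : (0 : ℝ) < k := by exact_mod_cast hk
  have hB0 : 0 < B := by linarith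
  rw [rate_of_pos _ hckm, EReal.coe_le_coe_iff]
  have h1 : Real.log (c (k * m)) ≤ k * Real.log B + k * Real.log (c m) := by
    rw [← Real.log_pow, ← Real.log_pow, ← Real.log_mul (by positivity) (by positivity)]
    refine Real.log_le_log hckm (hmul.trans ?_)
    exact mul_le_mul_of_nonneg_right (pow_le_pow_right₀ hB (Nat.sub_le k 1)) (by positivity)
  push_cast
  rw [← add_div, div_le_div_iff₀ (by positivity) hm']
  nlinarith

theorem le_rate_mul (hB : 1 ≤ B) {m k : ℕ} (hm : 0 < m) (hk : 1 ≤ k)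
    (hmul : c m ^ k ≤ B ^ (k - 1) * c (k * m)) (hcm : 0 < c m) (hckm : 0 < c (k * m)) :
    ((Real.log (c m) / m - Real.log B / m : ℝ) : EReal) ≤ rate (k * m) (c (k * m)) := by
  have hm' : (0 : ℝ) < m := by exact_mod_cast hm
  have hk' : (0 : ℝ) < k := by exact_mod_cast hk
  have hB0 : 0 < B := by linarith
  rw [rate_of_pos _ hckm, EReal.coe_le_coe_iff]
  have h1 : k * Real.log (c m) ≤ k * Real.log B + Real.log (c (k * m)) := by
    rw [← Real.log_pow, ← Real.log_pow, ← Real.log_mul (by positivity) (by positivity)]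
    refine Real.log_le_log (by positivity) (hmul.trans ?_)
    exact mul_le_mul_of_nonneg_right (pow_le_pow_right₀ hB (Nat.sub_le k 1)) hckm.le
  push_cast
  rw [← sub_div, div_le_div_iff₀ hm' (by positivity)]
  nlinarith

/-- A lower bound along the multiples of `m` with a subexponential loss bounds the rate of an
antitone sequence. -/
theorem le_liminf_rate {p : ℕ → ℝ} (hp0 : ∀ n, 0 ≤ p n) (hp : Antitone p) {m : ℕ} (hm : 0 < m)
    {v μ C : ℝ} (hμ : 0 < μ)
    (h : ∀ k : ℕ, k ≥ 1 → μ * Real.exp (k * m * v - C * √k) ≤ p (k * m)) :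
    (v : EReal) ≤ liminf (fun n => rate n (p n)) atTop := by
  have hm' : (0 : ℝ) < m := by exact_mod_cast hm
  refine le_of_forall_lt_imp_le_of_dense fun z hz => ?_
  obtain ⟨y, hzy, hy⟩ := EReal.lt_iff_exists_real_btwn.1 hz
  rw [EReal.coe_lt_coe_iff] at hy
  refine hzy.le.trans ?_
  set δ := v - y with hδ
  have hδ0 : 0 < δ := sub_pos.2 hy
  have hev : ∀ᶠ n : ℕ in atTop,
      -Real.log μ + m * |v| + δ / 2 + C ^ 2 / (2 * δ) < n * (δ / 2) :=
    (tendsto_natCast_atTop_atTop.atTop_mul_const (half_pos hδ0)).eventually_gt_atTop _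
  refine le_liminf_of_le (by isBoundedDefault) ?_
  filter_upwards [hev, eventually_ge_atTop 1] with n hn hn1
  rw [le_rate_iff hn1 (hp0 n)]
  -- Round up to a multiple of m, since an antitone sequence is bounded below by its later terms.
  set k := n / m + 1 with hk
  have hnk : n ≤ k * m := (Nat.lt_div_mul_add hm (a := n)).le.trans (by rw [hk]; ring_nf; rfl)
  have hkn : k * m ≤ n + m := by
    rw [hk, add_mul, one_mul]
    exact Nat.add_le_add_right (Nat.div_mul_le_self n m) m
  have hk1 : k ≤ n + 1 := Nat.add_le_add_right (Nat.div_le_self n m) 1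
  refine le_trans ?_ ((h k (Nat.le_add_left 1 _)).trans (hp hnk))
  rw [← Real.exp_log hμ, ← Real.exp_add, Real.exp_le_exp]
  have c1 : (n : ℝ) ≤ k * m := by exact_mod_cast hnk
  have c2 : (k * m : ℝ) ≤ n + m := by exact_mod_cast hkn
  have c3 : (k : ℝ) ≤ n + 1 := by exact_mod_cast hk1
  -- Completing the square absorbs √k into half of the slack δ k; the other half of δ n beats the
  -- constants.
  have h1 : C * √k ≤ δ / 2 * k + C ^ 2 / (2 * δ) := by
    have hs : √(k : ℝ) ^ 2 = k := Real.sq_sqrt (Nat.cast_nonneg k)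
    have : δ / 2 * k + C ^ 2 / (2 * δ) - C * √k = (δ * √k - C) ^ 2 / (2 * δ) := by
      field_simp
      linear_combination -(δ ^ 2) * hs
    have := div_nonneg (sq_nonneg (δ * √k - C)) (by linarith : 0 ≤ 2 * δ)
    linarith
  have h2 : (n : ℝ) * v - m * |v| ≤ k * m * v := by
    have e1 : (0 : ℝ) ≤ k * m - n := sub_nonneg.2 c1
    have e2 := mul_le_mul_of_nonneg_left (neg_abs_le v) e1
    have e3 := mul_le_mul_of_nonneg_right (by linarith : (k * m : ℝ) - n ≤ m) (abs_nonneg v)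
    linarith
  have h3 := mul_le_mul_of_nonneg_left c3 (half_pos hδ0).le
  have h4 : (n : ℝ) * v = n * y + n * δ := by rw [hδ]; ring
  linarith

end Rates

/-! ### The Chernoff bound for factorizing states -/

section Chernoff

variable {d : Type*} [Fintype d] [DecidableEq d] {𝒜 : StarSubalgebra ℂ (Matrix d d ℂ)}

/-- The limit of the normalized logarithms of the Chernoff traces. -/
def chernoffRate (ω σ : State 𝒜) (t : ℝ) : EReal :=
  limsup (fun n => rate n (chernoffTrace ω σ n t)) atTop

theorem minError_nonneg {κ : ℝ} (hκ : κ ∈ Ioo (0 : ℝ) 1) (ω σ : State 𝒜) (n : ℕ) :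
    0 ≤ minError κ ω σ n :=
  le_minError ω σ fun _ ha ha1 => errorProb_nonneg hκ ω σ ha ha1

theorem one_le_card_add_one_sq : (1 : ℝ) ≤ (Fintype.card d + 1) ^ 2 :=
  one_le_pow₀ (by simp)

theorem chernoffTrace_mul_le_of_upperFactorization {ω σ : State 𝒜}
    (hω : ω.UpperFactorization) (hσ : σ.UpperFactorization) :
    ∃ b₀ ≥ (1 : ℝ), ∃ m₀ : ℕ, ∀ b ≥ b₀, ∀ m ≥ m₀, ∀ k ≥ 1, ∀ t ∈ Icc (0 : ℝ) 1,
      chernoffTrace ω σ (k * m) t ≤ b ^ (k - 1) * chernoffTrace ω σ m t ^ k := by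
  obtain ⟨b₁, hb₁, m₁, h₁⟩ := State.density_le_of_upperFactorization hω
  obtain ⟨b₂, hb₂, m₂, h₂⟩ := State.density_le_of_upperFactorization hσ
  refine ⟨max b₁ b₂, hb₁.trans (le_max_left _ _), max m₁ m₂, fun b hb m hm k hk t ht => ?_⟩
  have hb0 : 0 < b := by linarith [le_max_left b₁ b₂]
  exact chernoffTrace_mul_le (pow_pos hb0 _)
    (h₁ b ((le_max_left _ _).trans hb) m ((le_max_left _ _).trans hm) k hk)
    (h₂ b ((le_max_right _ _).trans hb) m ((le_max_right _ _).trans hm) k hk) ht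

theorem tendsto_chernoffRate {ω σ : State 𝒜} (hω : ω.UpperFactorization)
    (hσ : σ.UpperFactorization) {t : ℝ} (ht : t ∈ Icc (0 : ℝ) 1) :
    Tendsto (fun n => rate n (chernoffTrace ω σ n t)) atTop (𝓝 (chernoffRate ω σ t)) := by
  obtain ⟨b, hb, m₀, h⟩ := chernoffTrace_mul_le_of_upperFactorization hω hσ
  exact tendsto_rate_limsup (fun n => chernoffTrace_nonneg ω σ n t) hb
    (one_le_card_add_one_sq (d := d)) (fun n => chernoffTrace_succ_le ω σ n ht)
    fun m hm k hk => h b le_rfl m hm k hk t ht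

theorem limsup_minError_le (ω σ : State 𝒜) {κ : ℝ} (hκ : κ ∈ Ioo (0 : ℝ) 1) :
    limsup (fun n => rate n (minError κ ω σ n)) atTop ≤
      ⨅ t ∈ Icc (0 : ℝ) 1, chernoffRate ω σ t :=
  le_iInf₂ fun _ ht => limsup_le_limsup
    (Eventually.of_forall fun n => rate_mono n (minError_le_chernoffTrace hκ ω σ n ht))

theorem tendsto_minError_of_le_liminf (ω σ : State 𝒜) {κ : ℝ} (hκ : κ ∈ Ioo (0 : ℝ) 1) {t : ℝ}
    (ht : t ∈ Icc (0 : ℝ) 1)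
    (h : chernoffRate ω σ t ≤ liminf (fun n => rate n (minError κ ω σ n)) atTop) :
    Tendsto (fun n => rate n (minError κ ω σ n)) atTop (𝓝 (chernoffRate ω σ t)) :=
  tendsto_of_le_liminf_of_limsup_le h ((limsup_minError_le ω σ hκ).trans (iInf₂_le t ht))

theorem chernoff_of_factorization {ω σ : State 𝒜} (hωu : ω.UpperFactorization)
    (hσu : σ.UpperFactorization) (hωl : ω.LowerFactorization) (hσl : σ.LowerFactorization) :
    ContinuousOn (chernoffRate ω σ) (Icc (0 : ℝ) 1) ∧
      ∃ t₀ ∈ Icc (0 : ℝ) 1, IsMinOn (chernoffRate ω σ) (Icc (0 : ℝ) 1) t₀ ∧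
        ∀ κ ∈ Ioo (0 : ℝ) 1,
          Tendsto (fun n : ℕ => rate n (minError κ ω σ n)) atTop
            (𝓝 (chernoffRate ω σ t₀)) := by
  obtain ⟨b₁, hb₁, m₁, h₁⟩ := chernoffTrace_mul_le_of_upperFactorization hωu hσu
  obtain ⟨b₂, hb₂, m₂, h₂⟩ := State.tensorPow_le_of_lowerFactorization hωl
  obtain ⟨b₃, hb₃, m₃, h₃⟩ := State.tensorPow_le_of_lowerFactorization hσl
  obtain ⟨b, hbb₁, hbb₂, hbb₃⟩ : ∃ b, b₁ ≤ b ∧ b₂ ≤ b ∧ b₃ ≤ b :=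
    ⟨max b₁ (max b₂ b₃), by simp, by simp, by simp⟩
  -- The extra 1 excludes m = 0, where dividing by m is meaningless.
  obtain ⟨M, hM1, hMm₁, hMm₂, hMm₃⟩ : ∃ M, 0 < M ∧ m₁ ≤ M ∧ m₂ ≤ M ∧ m₃ ≤ M :=
    ⟨m₁ + m₂ + m₃ + 1, by omega, by omega, by omega, by omega⟩
  have hb : 1 ≤ b := hb₁.le.trans hbb₁
  have hb0 : 0 < b := by linarith
  have hupper : ∀ m ≥ M, ∀ k ≥ 1, ∀ t ∈ Icc (0 : ℝ) 1,
      chernoffTrace ω σ (k * m) t ≤ b ^ (k - 1) * chernoffTrace ω σ m t ^ k :=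
    fun m hm => h₁ b hbb₁ m (hMm₁.trans hm)
  have hωd := fun m (hm : m ≥ M) => h₂ b hbb₂ m (hMm₂.trans hm)
  have hσd := fun m (hm : m ≥ M) => h₃ b hbb₃ m (hMm₃.trans hm)
  have hlower : ∀ m ≥ M, ∀ k ≥ 1, ∀ t ∈ Icc (0 : ℝ) 1,
      chernoffTrace ω σ m t ^ k ≤ b ^ (k - 1) * chernoffTrace ω σ (k * m) t :=
    fun m hm k hk t ht => chernoffTrace_pow_le (pow_pos hb0 _) (hωd m hm k hk) (hσd m hm k hk) ht
  -- One vanishing trace at a large m makes the rate -∞ for every t, and the upper bound then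
  -- settles everything. Otherwise all logarithms below are finite.
  by_cases hzero : ∃ m ≥ M, ∃ s, chernoffTrace ω σ m s = 0
  · obtain ⟨m, hm, s, hs⟩ := hzero
    have hbot : ∀ t ∈ Icc (0 : ℝ) 1, chernoffRate ω σ t = ⊥ := fun t ht =>
      limsup_rate_eq_bot (fun n => chernoffTrace_nonneg ω σ n t) hb
        (one_le_card_add_one_sq (d := d)) (fun n => chernoffTrace_succ_le ω σ n ht)
        (hM1.trans_le hm) (fun k hk => hupper m hm k hk t ht)
        (chernoffTrace_eq_zero_of_eq_zero ω σ m hs t)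
    have h0 : (0 : ℝ) ∈ Icc (0 : ℝ) 1 := ⟨le_rfl, zero_le_one⟩
    refine ⟨continuousOn_const.congr hbot, 0, h0, fun t _ => ?_, fun κ hκ =>
      tendsto_minError_of_le_liminf ω σ hκ h0 ?_⟩
    · change chernoffRate ω σ 0 ≤ chernoffRate ω σ t
      rw [hbot 0 h0]
      exact bot_le
    · rw [hbot 0 h0]
      exact bot_le
  push Not at hzero
  have hpos : ∀ m ≥ M, ∀ t, 0 < chernoffTrace ω σ m t := fun m hm t =>
    lt_of_le_of_ne (chernoffTrace_nonneg ω σ m t) (Ne.symm (hzero m hm t))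
  set F : ℕ → ℝ → ℝ := fun m t => Real.log (chernoffTrace ω σ m t) / m with hF
  have hsub : ∀ m ≥ M, Tendsto (fun k : ℕ => k * m) atTop atTop := fun m hm =>
    tendsto_id.atTop_mul_const' (hM1.trans_le hm)
  have hkm : ∀ m ≥ M, ∀ k ≥ 1, M ≤ k * m := fun m hm k hk =>
    hm.le.trans (Nat.le_mul_of_pos_left m hk)
  have hle : ∀ m ≥ M, ∀ t ∈ Icc (0 : ℝ) 1,
      chernoffRate ω σ t ≤ ((F m t + Real.log b / m : ℝ) : EReal) := fun m hm t ht =>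
    le_of_tendsto ((tendsto_chernoffRate hωu hσu ht).comp (hsub m hm))
      ((eventually_ge_atTop 1).mono fun k hk => rate_mul_le (c := fun n => chernoffTrace ω σ n t)
        hb (hM1.trans_le hm) hk (hupper m hm k hk t ht) (hpos m hm t) (hpos _ (hkm m hm k hk) t))
  have hge : ∀ m ≥ M, ∀ t ∈ Icc (0 : ℝ) 1,
      ((F m t - Real.log b / m : ℝ) : EReal) ≤ chernoffRate ω σ t := fun m hm t ht =>
    ge_of_tendsto ((tendsto_chernoffRate hωu hσu ht).comp (hsub m hm))
      ((eventually_ge_atTop 1).mono fun k hk => le_rate_mul (c := fun n => chernoffTrace ω σ n t)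
        hb (hM1.trans_le hm) hk (hlower m hm k hk t ht) (hpos m hm t) (hpos _ (hkm m hm k hk) t))
  set Ψ : ℝ → ℝ := fun t => (chernoffRate ω σ t).toReal with hΨ
  have hcoe : ∀ t ∈ Icc (0 : ℝ) 1, chernoffRate ω σ t = (Ψ t : EReal) := fun t ht =>
    (EReal.coe_toReal (ne_top_of_le_ne_top (EReal.coe_ne_top _) (hle M le_rfl t ht))
      (ne_bot_of_le_ne_bot (EReal.coe_ne_bot _) (hge M le_rfl t ht))).symm
  have hΨle : ∀ m ≥ M, ∀ t ∈ Icc (0 : ℝ) 1, Ψ t ≤ F m t + Real.log b / m := fun m hm t ht => by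
    have := hle m hm t ht
    rwa [hcoe t ht, EReal.coe_le_coe_iff] at this
  have hΨge : ∀ m ≥ M, ∀ t ∈ Icc (0 : ℝ) 1, F m t - Real.log b / m ≤ Ψ t := fun m hm t ht => by
    have := hge m hm t ht
    rwa [hcoe t ht, EReal.coe_le_coe_iff] at this
  have hlim : Tendsto (fun m : ℕ => Real.log b / m) atTop (𝓝 0) :=
    tendsto_const_div_atTop_nhds_zero_nat _
  -- The two-sided error (log b)/m does not involve t.
  have hunif : TendstoUniformlyOn F Ψ atTop (Icc 0 1) := by
    rw [Metric.tendstoUniformlyOn_iff]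
    intro ε hε
    filter_upwards [hlim.eventually_lt_const hε, eventually_ge_atTop M] with m hmε hm t ht
    rw [Real.dist_eq, abs_lt]
    constructor <;> linarith [hΨle m hm t ht, hΨge m hm t ht]
  have hΨc : ContinuousOn Ψ (Icc 0 1) := by
    refine hunif.continuousOn (Eventually.frequently ?_)
    filter_upwards [eventually_ge_atTop M] with m hm
    exact (((continuous_chernoffTrace ω σ m).log fun t => (hpos m hm t).ne').div_const
      _).continuousOn
  obtain ⟨t₀, ht₀, hmin⟩ := isCompact_Icc.exists_isMinOn (nonempty_Icc.2 zero_le_one) hΨc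
  refine ⟨(continuous_coe_real_ereal.comp_continuousOn hΨc).congr hcoe, t₀, ht₀, fun t ht => ?_,
    fun κ hκ => tendsto_minError_of_le_liminf ω σ hκ ht₀ ?_⟩
  · change chernoffRate ω σ t₀ ≤ chernoffRate ω σ t
    rw [hcoe t ht, hcoe t₀ ht₀, EReal.coe_le_coe_iff]
    exact hmin ht
  -- One (log b)/m pays for passing to product states, the other for comparing the trace on m sites
  -- with the limit. The exponent `t` varies with m, but Ψ t ≥ Ψ t₀ makes the bound independent of
  -- it.
  have hbound : ∀ m ≥ M, ((Ψ t₀ - 2 * (Real.log b / m) : ℝ) : EReal) ≤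
      liminf (fun n => rate n (minError κ ω σ n)) atTop := by
    intro m hm
    have hm0 : 0 < m := hM1.trans_le hm
    have hm' : (0 : ℝ) < m := by exact_mod_cast hm0
    obtain ⟨t, ht, C, h⟩ := exists_pow_chernoffTrace_le_minError ω σ m
    have hμ : 0 < min κ (1 - κ) / 2 := half_pos (lt_min hκ.1 (sub_pos.2 hκ.2))
    refine le_liminf_rate (fun n => minError_nonneg hκ ω σ n) (minError_antitone hκ ω σ) hm0 hμ
      (C := C) fun k hk => ?_
    have hk0 := h κ hκ k (b ^ (k - 1)) (pow_pos hb0 _) (hωd m hm k hk) (hσd m hm k hk)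
    have hk1 : b ^ (k - 1) * minError κ ω σ (k * m) ≤ b ^ k * minError κ ω σ (k * m) :=
      mul_le_mul_of_nonneg_right (pow_le_pow_right₀ hb (Nat.sub_le k 1))
        (minError_nonneg hκ ω σ _)
    refine le_of_mul_le_mul_left (le_trans ?_ (hk0.trans hk1)) (pow_pos hb0 k)
    have e1 : b ^ k = Real.exp (k * Real.log b) := by
      rw [Real.exp_nat_mul, Real.exp_log hb0]
    have e2 : chernoffTrace ω σ m t ^ k =
        Real.exp (k * Real.log (chernoffTrace ω σ m t)) := by
      rw [Real.exp_nat_mul, Real.exp_log (hpos m hm t)]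
    rw [e1, e2, ← Real.exp_add, mul_left_comm, ← Real.exp_add]
    refine mul_le_mul_of_nonneg_left (Real.exp_le_exp.2 ?_) hμ.le
    have h4 := hΨle m hm t ht
    have h5 : Ψ t₀ ≤ Ψ t := hmin ht
    have h6 : (m : ℝ) * (Ψ t₀ - Real.log b / m) ≤ Real.log (chernoffTrace ω σ m t) := by
      have : Ψ t₀ - Real.log b / m ≤ Real.log (chernoffTrace ω σ m t) / m := by
        have : F m t = Real.log (chernoffTrace ω σ m t) / m := rfl
        linarith
      rwa [le_div_iff₀ hm', mul_comm] at this
    have h7 := mul_le_mul_of_nonneg_left h6 (Nat.cast_nonneg (α := ℝ) k)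
    have e3 : (k : ℝ) * m * (Ψ t₀ - 2 * (Real.log b / m)) =
        k * (m * (Ψ t₀ - Real.log b / m)) - k * Real.log b := by
      field_simp
      ring
    rw [e3]
    linarith
  rw [hcoe t₀ ht₀]
  have hlim2 : Tendsto (fun m : ℕ => ((Ψ t₀ - 2 * (Real.log b / m) : ℝ) : EReal)) atTop
      (𝓝 ((Ψ t₀ : ℝ) : EReal)) := by
    refine (continuous_coe_real_ereal.tendsto _).comp ?_
    simpa using (hlim.const_mul 2).const_sub (Ψ t₀)
  exact le_of_tendsto hlim2 ((eventually_ge_atTop M).mono hbound)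

end Chernoff

end SpinChain

end

theorem theorem6p1 {d : Type*} [Fintype d] [DecidableEq d]
    (𝒜 : StarSubalgebra ℂ (Matrix d d ℂ)) (ω σ : SpinChain.State 𝒜)
    (hω : ω.TranslationInvariant) (hσ : σ.TranslationInvariant)
    (hωu : ω.UpperFactorization) (hσu : σ.UpperFactorization) :
    ∃ ψ : ℝ → EReal,
      (∀ t ∈ Icc (0 : ℝ) 1,
        Tendsto (fun n : ℕ => SpinChain.rate n (SpinChain.chernoffTrace ω σ n t)) atTop
          (𝓝 (ψ t))) ∧
      (∀ κ ∈ Ioo (0 : ℝ) 1,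
        limsup (fun n : ℕ => SpinChain.rate n (SpinChain.minError κ ω σ n)) atTop ≤
          ⨅ t ∈ Icc (0 : ℝ) 1, ψ t) ∧
      (ω.LowerFactorization → σ.LowerFactorization →
        ContinuousOn ψ (Icc (0 : ℝ) 1) ∧
        ∃ t₀ ∈ Icc (0 : ℝ) 1, IsMinOn ψ (Icc (0 : ℝ) 1) t₀ ∧
          ∀ κ ∈ Ioo (0 : ℝ) 1,
            Tendsto (fun n : ℕ => SpinChain.rate n (SpinChain.minError κ ω σ n)) atTop
              (𝓝 (ψ t₀))) := by
  exact ⟨SpinChain.chernoffRate ω σ,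
    fun _ ht => SpinChain.tendsto_chernoffRate hωu hσu ht,
    fun _ hκ => SpinChain.limsup_minError_le ω σ hκ,
    fun hωl hσl => SpinChain.chernoff_of_factorization hωu hσu hωl hσl⟩
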